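/- Consider real transformations of the part $y'\neq 0$ of the space of variables $(x,y,y')\in\mathbb R^3$. A uniform contact symmetry of $y''=\omega(x,y,y')$ is a smooth diffeomorphism $\Gamma:(x,y,y')\mapsto(\hat x,\hat y,\hat y')$ from an open set onto its image, of the form $\hat x=\Phi(x,y')$, $\hat y=ky+\Theta(x,y')$, $\hat y'=\Psi(x,y')$ with a constant $k\in\mathbb R\setminus\{0\}$, satisfying the contact conditions $\hat y_x+y'\hat y_y=(\hat x_x+y'\hat x_y)\hat y'$, $\hat y_{y'}=\hat x_{y'}\hat y'$, and the symmetry condition $D\hat y'/D\hat x=\omega(\hat x,\hat y,\hat y')$ (with $D\hat x\neq0$) whenever $y''=\omega(x,y,y')$, at all points where $\omega$ is defined both at $(x,y,y')$ and at its image; here $D=\partial_x+y'\partial_y+\omega\,\partial_{y'}$. Its infinitesimal generators on an open set are the smooth vector fields $X=\xi\partial_x+\eta\partial_y+\eta^{(1)}\partial_{y'}$ with $\xi=-Q_{y'}$, $\eta=Q-y'Q_{y'}$, $\eta^{(1)}=Q_x+y'Q_y$, $Q=c\,y+\varphi(x,y')$, $c\in\mathbb R$, that satisfy the linearized symmetry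 condition $D\eta^{(1)}-\omega D\xi=X\omega$ wherever $\omega$ is defined. Two symmetries on a connected open set are equivalent if they differ by composition with finitely many maps $\exp(X)$, where each $X$ is a generator on a connected open part of $\{y'\ne0\}$ in which its flow stays. Let $\mathfrak a(1)$ be the real Lie algebra with basis $X_1,X_2$ and $[X_1,X_2]=X_1$, and let $$\Gamma_1=(-x,y,-y'),\qquad \Gamma_2=(x,-y,-y'),\qquad \Gamma_3=(xy'^2,\;2xy'-y,\;1/y').$$ (1) For the equation $y''=\dfrac{y'^2}{3xy'-4y}$, on every non-empty connected open subset of $\{y'\neq0\}$ the generators form a Lie algebra isomorphic to $\mathfrak a(1)\oplus\mathfrak a(1)$. The fields $X_1=2y'\partial_x+y'^2\partial_y$, $X_2=\frac34x\partial_x+\frac12y\partial_y-\frac14y'\partial_{y'}$, $X_3=2y'^{-3}\partial_x+3y'^{-2}\partial_y$, $X_4=\frac14x\partial_x+\frac12y\partial_y+\frac14y'\partial_{y'}$ form a basis, and their only non-zero commutators, up to antisymmetry, are $[X_1,X_2]=X_1$ and $[X_3,X_4]=X_3$. (2) For the same equation, $\Gamma_1,\Gamma_2,\Gamma_3$ generate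 a group $G\cong\mathbb Z_2\times\mathbb Z_2\times\mathbb Z_2$ of uniform contact symmetries on $\{y'\neq0\}$. Every uniform contact symmetry defined on a non-empty connected open subset of $\{y'\ne0\}$ is equivalent to exactly one element of $G$, and if $\Gamma,\Gamma'$ are equivalent to $d,d'\in G$ and can be composed, then $\Gamma'\circ\Gamma$ is equivalent to $d'd$. That is, the group of inequivalent discrete uniform contact symmetries is $G$. (3) For every $m\in\mathbb R\setminus\{0\}$, statement (2) also holds for the equation $y''=\dfrac{m\,y'^2}{y-(m+1)xy'}$. For $m<0$, on every non-empty connected open subset of $\{y'\neq0\}$, the Lie algebra of generators of this equation is again isomorphic to $\mathfrak a(1)\oplus\mathfrak a(1)$. -/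

import Mathlib

open scoped ContDiff

noncomputable section

namespace UniformContact

/-! ### The Lie algebra `𝔞(1)` -/

/-- The two-dimensional non-abelian real Lie algebra `𝔞(1)`, with basis `X₁ = (1, 0)`,
`X₂ = (0, 1)` and bracket `[X₁, X₂] = X₁`. -/
@[ext] structure A1 where
  fst : ℝ
  snd : ℝ

namespace A1

/-- The identification of `𝔞(1)` with coordinate pairs. -/
def equivProd : A1 ≃ ℝ × ℝ where
  toFun u := (u.fst, u.snd)
  invFun v := ⟨v.1, v.2⟩
  left_inv _ := rfl
  right_inv _ := rfl

instance : AddCommGroup A1 := equivProd.addCommGroup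

instance : Module ℝ A1 := equivProd.module ℝ

@[simp] theorem add_fst (u v : A1) : (u + v).fst = u.fst + v.fst := rfl
@[simp] theorem add_snd (u v : A1) : (u + v).snd = u.snd + v.snd := rfl
@[simp] theorem zero_fst : (0 : A1).fst = 0 := rfl
@[simp] theorem zero_snd : (0 : A1).snd = 0 := rfl
@[simp] theorem smul_fst (t : ℝ) (u : A1) : (t • u).fst = t * u.fst := rfl
@[simp] theorem smul_snd (t : ℝ) (u : A1) : (t • u).snd = t * u.snd := rfl

instance : Bracket A1 A1 where
  bracket u v := ⟨u.fst * v.snd - u.snd * v.fst, 0⟩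

@[simp] theorem bracket_fst (u v : A1) : ⁅u, v⁆.fst = u.fst * v.snd - u.snd * v.fst := rfl
@[simp] theorem bracket_snd (u v : A1) : ⁅u, v⁆.snd = 0 := rfl

instance : LieRing A1 where
  add_lie u v w := by ext <;> simp; ring
  lie_add u v w := by ext <;> simp; ring
  lie_self u := by ext <;> simp; ring
  leibniz_lie u v w := by ext <;> simp; ring

instance : LieAlgebra ℝ A1 where
  lie_smul t u v := by ext <;> simp; ring

/-- The basis element `X₁`. -/
def e₁ : A1 := ⟨1, 0⟩

/-- The basis element `X₂`. -/
def e₂ : A1 := ⟨0, 1⟩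

end A1

/-! ### Second-order equations and uniform contact symmetries -/

/-- The space with coordinates `(x, y, p)`, where `p` stands for `y'`. -/
abbrev Jet := ℝ × ℝ × ℝ

/-- A second-order equation `y'' = ω(x, y, y')`, where `ω` is defined on `dom`. The values of
`rhs` outside `dom` are irrelevant. -/
structure ODE2 where
  dom : Set Jet
  rhs : Jet → ℝ

/-- The total derivative `D f = f_x + p f_y + ω f_p`, taken on the equation `y'' = ω`. -/
def ODE2.totalD (O : ODE2) (f : Jet → ℝ) (P : Jet) : ℝ :=
  fderiv ℝ f P (1, P.2.2, O.rhs P)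

/-- The partial derivative with respect to `x`. -/
def dx (f : Jet → ℝ) (P : Jet) : ℝ := fderiv ℝ f P (1, 0, 0)

/-- The partial derivative with respect to `y`. -/
def dy (f : Jet → ℝ) (P : Jet) : ℝ := fderiv ℝ f P (0, 1, 0)

/-- The partial derivative with respect to `p`. -/
def dp (f : Jet → ℝ) (P : Jet) : ℝ := fderiv ℝ f P (0, 0, 1)

/-- `Γ : (x, y, p) ↦ (x̂, ŷ, p̂)` has the uniform form
`x̂ = Φ(x, p)`, `ŷ = k y + Θ(x, p)`, `p̂ = Ψ(x, p)` on `V`, with a constant `k ≠ 0`. -/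
def HasUniformForm (V : Set Jet) (Γ : Jet → Jet) : Prop :=
  ∃ (k : ℝ) (Φ Θ Ψ : ℝ → ℝ → ℝ), k ≠ 0 ∧
    ∀ P ∈ V, Γ P = (Φ P.1 P.2.2, k * P.2.1 + Θ P.1 P.2.2, Ψ P.1 P.2.2)

/-- The contact condition `ŷ_x + p ŷ_y = (x̂_x + p x̂_y) p̂`, `ŷ_p = x̂_p p̂` at the point `P`. -/
def ContactAt (Γ : Jet → Jet) (P : Jet) : Prop :=
  dx (fun R => (Γ R).2.1) P + P.2.2 * dy (fun R => (Γ R).2.1) P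
      = (dx (fun R => (Γ R).1) P + P.2.2 * dy (fun R => (Γ R).1) P) * (Γ P).2.2 ∧
    dp (fun R => (Γ R).2.1) P = dp (fun R => (Γ R).1) P * (Γ P).2.2

/-- The symmetry condition at `P`: if the equation is defined at `P` and at `Γ(P)`, then
`ŷ'' = D p̂ / D x̂` exists and equals `ω(x̂, ŷ, p̂)` when `y'' = ω(x, y, p)`. -/
def ODE2.SymmetryAt (O : ODE2) (Γ : Jet → Jet) (P : Jet) : Prop :=
  P ∈ O.dom → Γ P ∈ O.dom →
    O.totalD (fun R => (Γ R).1) P ≠ 0 ∧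
    O.totalD (fun R => (Γ R).2.2) P / O.totalD (fun R => (Γ R).1) P = O.rhs (Γ P)

/-- `Γ`, restricted to the open set `V`, is a uniform contact symmetry of `O`: a diffeomorphism
onto its image, of uniform form, satisfying the contact and symmetry conditions. -/
structure ODE2.IsUniformContactSymmetryOn (O : ODE2) (V : Set Jet) (Γ : Jet → Jet) : Prop where
  contDiffOn : ContDiffOn ℝ ∞ Γ V
  injOn : Set.InjOn Γ V
  isInvertible : ∀ P ∈ V, (fderiv ℝ Γ P).IsInvertible
  uniform : HasUniformForm V Γ
  contact : ∀ P ∈ V, ContactAt Γ P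
  symmetry : ∀ P ∈ V, O.SymmetryAt Γ P

/-! ### Infinitesimal generators -/

/-- The contact vector field `ξ ∂_x + η ∂_y + η⁽¹⁾ ∂_p` with characteristic function `Q`:
`ξ = -Q_p`, `η = Q - p Q_p`, `η⁽¹⁾ = Q_x + p Q_y`. -/
def contactField (Q : Jet → ℝ) (P : Jet) : Jet :=
  (-dp Q P, Q P - P.2.2 * dp Q P, dx Q P + P.2.2 * dy Q P)

/-- The linearized symmetry condition for the vector field `X = (ξ, η, η⁽¹⁾)` at `P`:
`η⁽²⁾ = ξ ω_x + η ω_y + η⁽¹⁾ ω_p` when `y'' = ω`, where `η⁽²⁾ = D η⁽¹⁾ - y'' D ξ`. -/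
def ODE2.LinearizedSymmetryAt (O : ODE2) (X : Jet → Jet) (P : Jet) : Prop :=
  P ∈ O.dom →
    O.totalD (fun R => (X R).2.2) P - O.rhs P * O.totalD (fun R => (X R).1) P
      = fderiv ℝ O.rhs P (X P)

/-- The set of generators of uniform Lie contact symmetries of `O` on the open set `V`: the
smooth vector fields on `V` whose characteristic function is `Q = c y + φ(x, p)` with a constant
`c`, and which satisfy the linearized symmetry condition. A vector field on `V` is
represented by its extension by zero. -/
def ODE2.uniformGenerators (O : ODE2) (V : Set Jet) : Set (Jet → Jet) :=
  {X | (∀ P ∉ V, X P = 0) ∧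
    ∃ (c : ℝ) (φ : ℝ → ℝ → ℝ),
      ContDiffOn ℝ ∞ (fun P : Jet => c * P.2.1 + φ P.1 P.2.2) V ∧
      (∀ P ∈ V, X P = contactField (fun R : Jet => c * R.2.1 + φ R.1 R.2.2) P) ∧
      ∀ P ∈ V, O.LinearizedSymmetryAt X P}

/-- `e` is an isomorphism from the Lie algebra `L` onto the Lie algebra of generators of uniform
contact symmetries of `O` on `V`, with the commutator of vector fields. -/
structure ODE2.IsGeneratorIso (O : ODE2) (V : Set Jet) {L : Type*} [LieRing L] [LieAlgebra ℝ L]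
    (e : L →ₗ[ℝ] (Jet → Jet)) : Prop where
  injective : Function.Injective e
  range_eq : Set.range e = O.uniformGenerators V
  map_lie : ∀ u v : L, e ⁅u, v⁆ = VectorField.lieBracket ℝ (e u) (e v)

/-! ### Equivalence under continuous symmetries -/

/-- The part `y' ≠ 0` of the jet space. -/
def phase : Set Jet := {P | P.2.2 ≠ 0}

/-- `Γ' = exp(X) ∘ Γ` on `V`, where `exp(X)` is the time-one map of the flow of a generator `X`
of uniform Lie contact symmetries on some connected open part `N` of `phase`. -/
def ODE2.FlowStep (O : ODE2) (V : Set Jet) (Γ Γ' : Jet → Jet) : Prop :=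
  ∃ (N : Set Jet) (X : Jet → Jet) (γ : ℝ → Jet → Jet),
    IsOpen N ∧ IsConnected N ∧ N ⊆ phase ∧ X ∈ O.uniformGenerators N ∧
    ∀ P ∈ V, γ 0 P = Γ P ∧ γ 1 P = Γ' P ∧
      ∀ t ∈ Set.Icc (0 : ℝ) 1, γ t P ∈ N ∧ HasDerivAt (fun s => γ s P) (X (γ t P)) t

/-- Equivalence on `V` under the continuous uniform contact symmetries of `O`, that is under
finite compositions of maps `exp(X)`. -/
def ODE2.ContEquiv (O : ODE2) (V : Set Jet) : (Jet → Jet) → (Jet → Jet) → Prop :=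
  Relation.EqvGen (O.FlowStep V)

/-! ### The three discrete symmetries -/

/-- `Γ₁ : (x, y, y') ↦ (-x, y, -y')`. -/
def Γ₁ : Equiv.Perm phase where
  toFun P := ⟨(-P.1.1, P.1.2.1, -P.1.2.2), neg_ne_zero.mpr P.2⟩
  invFun P := ⟨(-P.1.1, P.1.2.1, -P.1.2.2), neg_ne_zero.mpr P.2⟩
  left_inv P := by simp
  right_inv P := by simp

/-- `Γ₂ : (x, y, y') ↦ (x, -y, -y')`. -/
def Γ₂ : Equiv.Perm phase where
  toFun P := ⟨(P.1.1, -P.1.2.1, -P.1.2.2), neg_ne_zero.mpr P.2⟩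
  invFun P := ⟨(P.1.1, -P.1.2.1, -P.1.2.2), neg_ne_zero.mpr P.2⟩
  left_inv P := by simp
  right_inv P := by simp

/-- The formula `(x, y, y') ↦ (x y'², 2 x y' - y, 1 / y')` for the third symmetry. -/
def legendreMap (P : phase) : phase :=
  ⟨(P.1.1 * P.1.2.2 ^ 2, 2 * P.1.1 * P.1.2.2 - P.1.2.1, P.1.2.2⁻¹), inv_ne_zero P.2⟩

theorem legendreMap_legendreMap (P : phase) : legendreMap (legendreMap P) = P := by
  obtain ⟨⟨x, y, p⟩, hp⟩ := P
  have hp' : p ≠ 0 := hp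
  simp only [legendreMap, Subtype.mk.injEq, Prod.mk.injEq]
  refine ⟨by field_simp, by field_simp; ring, by simp⟩

/-- `Γ₃ : (x, y, y') ↦ (x y'², 2 x y' - y, 1 / y')`. -/
def Γ₃ : Equiv.Perm phase where
  toFun := legendreMap
  invFun := legendreMap
  left_inv := legendreMap_legendreMap
  right_inv := legendreMap_legendreMap

/-- The group generated by `Γ₁`, `Γ₂` and `Γ₃`. -/
def discreteGroup : Subgroup (Equiv.Perm phase) := Subgroup.closure {Γ₁, Γ₂, Γ₃}

open Classical in
/-- A bijection of `phase` as a map on the whole jet space; only its values on `phase`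
matter. -/
def toMap (d : Equiv.Perm phase) (P : Jet) : Jet :=
  if h : P ∈ phase then (d ⟨P, h⟩ : Jet) else P

/-- The inequivalent discrete uniform contact symmetries of `O` form the group generated by
`Γ₁`, `Γ₂`, `Γ₃`, which is isomorphic to `ℤ₂ × ℤ₂ × ℤ₂`. -/
structure ODE2.DiscreteSymmetriesGenerated (O : ODE2) : Prop where
  /-- The group generated by `Γ₁`, `Γ₂`, `Γ₃` is `ℤ₂ × ℤ₂ × ℤ₂`. -/
  iso : Nonempty (discreteGroup ≃* Multiplicative (ZMod 2 × ZMod 2 × ZMod 2))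
  /-- Its elements are uniform contact symmetries. -/
  isSymmetry : ∀ d ∈ discreteGroup, O.IsUniformContactSymmetryOn phase (toMap d)
  /-- Every uniform contact symmetry, on any connected domain, is equivalent under the continuous
  symmetries to exactly one of its elements. -/
  classification : ∀ V : Set Jet, IsOpen V → IsConnected V → V ⊆ phase →
    ∀ Γ : Jet → Jet, O.IsUniformContactSymmetryOn V Γ →
      ∃! d : Equiv.Perm phase, d ∈ discreteGroup ∧ O.ContEquiv V (toMap d) Γ
  /-- Composition of symmetries corresponds to multiplication in the group. -/
  composition : ∀ V V' : Set Jet, IsOpen V → IsConnected V → V ⊆ phase →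
    IsOpen V' → IsConnected V' → V' ⊆ phase →
    ∀ Γ Γ' : Jet → Jet, O.IsUniformContactSymmetryOn V Γ → O.IsUniformContactSymmetryOn V' Γ' →
      Set.MapsTo Γ V V' → ∀ d ∈ discreteGroup, ∀ d' ∈ discreteGroup,
        O.ContEquiv V (toMap d) Γ → O.ContEquiv V' (toMap d') Γ' →
        O.ContEquiv V (toMap (d' * d)) (Γ' ∘ Γ)

/-! ### The equations -/

/-- The equation `y'' = y'² / (3 x y' - 4 y)`. -/
def mainODE : ODE2 where
  dom := {P | 3 * P.1 * P.2.2 - 4 * P.2.1 ≠ 0}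
  rhs P := P.2.2 ^ 2 / (3 * P.1 * P.2.2 - 4 * P.2.1)

/-- The equation `y'' = m y'² / (y - (m + 1) x y')`. -/
def familyODE (m : ℝ) : ODE2 where
  dom := {P | P.2.1 - (m + 1) * P.1 * P.2.2 ≠ 0}
  rhs P := m * P.2.2 ^ 2 / (P.2.1 - (m + 1) * P.1 * P.2.2)

/-- `X₁ = 2 y' ∂_x + y'² ∂_y`. -/
def X₁ (P : Jet) : Jet := (2 * P.2.2, P.2.2 ^ 2, 0)

/-- `X₂ = (3/4) x ∂_x + (1/2) y ∂_y - (1/4) y' ∂_{y'}`. -/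
def X₂ (P : Jet) : Jet := (3 / 4 * P.1, 1 / 2 * P.2.1, -(1 / 4) * P.2.2)

/-- `X₃ = 2 y'⁻³ ∂_x + 3 y'⁻² ∂_y`. -/
def X₃ (P : Jet) : Jet := (2 * (P.2.2 ^ 3)⁻¹, 3 * (P.2.2 ^ 2)⁻¹, 0)

/-- `X₄ = (1/4) x ∂_x + (1/2) y ∂_y + (1/4) y' ∂_{y'}`. -/
def X₄ (P : Jet) : Jet := (1 / 4 * P.1, 1 / 2 * P.2.1, 1 / 4 * P.2.2)

end UniformContact

end

noncomputable section

namespace UniformContact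

/-! ### Partial derivatives -/

/-! On `phase` use the coordinates `p`, `z = x p`, `w = y - x p`, and write `W = y - (m + 1) x p`,
so that `ω = m p² / W`. The main equation is the case `m = -1/4`.

Uniform form means that a characteristic function, or the map itself, is affine in `y` with constant
slope. Moving along a vertical line changes only `W`; after clearing denominators each symmetry
condition is a quadratic in `W` with infinitely many zeros, so its three coefficients vanish
(`determining_equations`, `finite_determining_equations`).

Infinitesimally this forces `Q = c y + α x p + h(p)` with the Euler equation `p (p h')' = -h / m`:
two scalings and a two-dimensional space of translations. For `m < 0` put `-1/m = μ²`; then `|p| ^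
μ` and `|p| ^ (-μ)` span the translations, suitable scalings each act on one of them and kill the
other, and the algebra is a sum of two copies of `𝔞(1)`.

For finite symmetries, the determining equations and the contact conditions give `(p p̂_p)² = p̂²`,
hence `p̂ = l p ^ ε` with `ε = ±1`, and `z`, `w` are scaled and shifted by an Euler solution in `p̂`
(`exists_normalFormOn`). Flows remove the shift and the absolute values of the scale factors
(`NormalFormOn.contEquiv`), leaving three signs, which are the elements of the discrete group. Every
flow multiplies `p` by a positive constant, and also differences of `w` between points with equal
`p`; these invariants separate the eight sign patterns (`comparable_of_flowStep`,
`eq_of_comparable`). Composing normal forms multiplies the signs. -/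

theorem fderiv_jet_apply (F : Jet → ℝ) (P : Jet) (a b c : ℝ) :
    fderiv ℝ F P (a, b, c) = a * dx F P + b * dy F P + c * dp F P := by
  have h : ((a, b, c) : Jet)
      = a • ((1, 0, 0) : Jet) + b • ((0, 1, 0) : Jet) + c • ((0, 0, 1) : Jet) := by
    simp
  rw [h, map_add, map_add, map_smul, map_smul, map_smul]
  rfl

theorem fderiv_jet_ext {f g : Jet →L[ℝ] ℝ} (hx : f (1, 0, 0) = g (1, 0, 0))
    (hy : f (0, 1, 0) = g (0, 1, 0)) (hp : f (0, 0, 1) = g (0, 0, 1)) : f = g := by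
  refine ContinuousLinearMap.ext fun v => ?_
  have h : v = v.1 • ((1, 0, 0) : Jet) + v.2.1 • ((0, 1, 0) : Jet)
      + v.2.2 • ((0, 0, 1) : Jet) := by
    simp
  rw [h]
  simp only [map_add, map_smul, hx, hy, hp]

theorem _root_.HasFDerivAt.real_div {E : Type*} [NormedAddCommGroup E] [NormedSpace ℝ E]
    {f g : E → ℝ} {f' g' : E →L[ℝ] ℝ} {P : E} (hf : HasFDerivAt f f' P) (hg : HasFDerivAt g g' P)
    (h0 : g P ≠ 0) :
    HasFDerivAt (fun R => f R / g R) ((g P)⁻¹ • f' - (f P / g P ^ 2) • g') P := by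
  refine (hf.mul ((hasDerivAt_inv h0).comp_hasFDerivAt P hg)).congr_fderiv ?_
  ext v
  simp
  ring

theorem contDiffOn_fderiv_apply {V : Set Jet} (hV : IsOpen V) {F : Jet → ℝ}
    (hF : ContDiffOn ℝ ∞ F V) (v : Jet) : ContDiffOn ℝ ∞ (fun P => fderiv ℝ F P v) V :=
  (hF.fderiv_of_isOpen hV (by simp)).clm_apply contDiffOn_const

theorem fderiv_fderiv_apply_comm {F : Jet → ℝ} {P : Jet} (hF : ContDiffAt ℝ ∞ F P) (u v : Jet) :
    fderiv ℝ (fun R => fderiv ℝ F R u) P v = fderiv ℝ (fun R => fderiv ℝ F R v) P u := by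
  have hd : DifferentiableAt ℝ (fderiv ℝ F) P :=
    (hF.fderiv_right (m := 1) (by norm_cast)).differentiableAt (by simp)
  have hs : IsSymmSndFDerivAt ℝ F P := hF.isSymmSndFDerivAt (by simp; norm_cast)
  rw [fderiv_clm_apply hd (differentiableAt_const u), fderiv_clm_apply hd (differentiableAt_const v)]
  simpa using hs v u

/-- A quadratic polynomial whose product with two nonzero affine factors vanishes on an infinite
set is zero. -/
theorem quadratic_coeff_eq_zero {s : Set ℝ} (hs : s.Infinite) {a b c k T : ℝ} (hk : k ≠ 0)
    (h : ∀ t ∈ s, t ≠ 0 → k * t + T ≠ 0 → a * t ^ 2 + b * t + c = 0) :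
    a = 0 ∧ b = 0 ∧ c = 0 := by
  open Polynomial in
  have h0 : (C a * X ^ 2 + C b * X + C c : ℝ[X]) * (X * (C k * X + C T)) = 0 := by
    apply Polynomial.eq_zero_of_infinite_isRoot
    refine hs.mono fun t ht => ?_
    simp only [Set.mem_ofPred_eq, IsRoot.def, eval_mul, eval_add, eval_C, eval_X, eval_pow]
    by_cases h1 : t = 0
    · simp [h1]
    by_cases h2 : k * t + T = 0
    · simp [h2]
    rw [h t ht h1 h2, zero_mul]
  have h1 : (Polynomial.X * (Polynomial.C k * Polynomial.X + Polynomial.C T) : Polynomial ℝ) ≠ 0 :=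
    mul_ne_zero Polynomial.X_ne_zero fun h => hk <| by
      simpa using congrArg (fun p => Polynomial.coeff p 1) h
  have h2 := (mul_eq_zero.mp h0).resolve_right h1
  refine ⟨?_, ?_, ?_⟩
  · simpa [Polynomial.coeff_X, Polynomial.coeff_C] using congrArg (fun p => Polynomial.coeff p 2) h2
  · simpa [Polynomial.coeff_X, Polynomial.coeff_C] using congrArg (fun p => Polynomial.coeff p 1) h2
  · simpa [Polynomial.coeff_X, Polynomial.coeff_C] using congrArg (fun p => Polynomial.coeff p 0) h2

/-! ### The Euler equation `p (p h')' = κ h` -/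

/-- `h` solves `p (p h')' = κ h` on `p ≠ 0`, with `h₁ = p h'`. -/
structure IsEuler (κ : ℝ) (h h₁ : ℝ → ℝ) : Prop where
  fst : ∀ p ≠ 0, HasDerivAt h (h₁ p / p) p
  snd : ∀ p ≠ 0, HasDerivAt h₁ (κ * h p / p) p

namespace IsEuler

variable {κ : ℝ} {h h₁ g g₁ : ℝ → ℝ}

theorem zero : IsEuler κ (fun _ => 0) (fun _ => 0) :=
  ⟨fun p _ => by simpa using hasDerivAt_const p (0 : ℝ),
    fun p _ => by simpa using hasDerivAt_const p (0 : ℝ)⟩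

theorem linearCombination (H : IsEuler κ h h₁) (G : IsEuler κ g g₁) (a b : ℝ) :
    IsEuler κ (fun p => a * h p + b * g p) (fun p => a * h₁ p + b * g₁ p) := by
  constructor <;> intro p hp
  · refine HasDerivAt.congr_deriv (((H.fst p hp).const_mul a).add ((G.fst p hp).const_mul b)) ?_
    ring
  · refine HasDerivAt.congr_deriv (((H.snd p hp).const_mul a).add ((G.snd p hp).const_mul b)) ?_
    ring

theorem comp_div (H : IsEuler κ h h₁) {c : ℝ} (hc : c ≠ 0) :
    IsEuler κ (fun p => h (p / c)) (fun p => h₁ (p / c)) := by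
  constructor <;> intro p hp
  · refine HasDerivAt.congr_deriv ((H.fst (p / c) (div_ne_zero hp hc)).comp p
      ((hasDerivAt_id p).div_const c)) ?_
    field_simp
  · refine HasDerivAt.congr_deriv ((H.snd (p / c) (div_ne_zero hp hc)).comp p
      ((hasDerivAt_id p).div_const c)) ?_
    field_simp

/-- The operator `p d/dp` changes sign under `p ↦ 1/p`; the minus sign on `h` makes the companion
function exactly `h₁ p⁻¹`. -/
theorem comp_inv (H : IsEuler κ h h₁) : IsEuler κ (fun p => -h p⁻¹) (fun p => h₁ p⁻¹) := by
  constructor <;> intro p hp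
  · refine HasDerivAt.congr_deriv (((H.fst p⁻¹ (inv_ne_zero hp)).comp p (hasDerivAt_inv hp)).neg) ?_
    field_simp
  · refine HasDerivAt.congr_deriv ((H.snd p⁻¹ (inv_ne_zero hp)).comp p (hasDerivAt_inv hp)) ?_
    field_simp

/-- Bootstrapping: `h' = h₁ / p` and `h₁' = κ h / p`, so both functions gain one derivative at each
step of a joint induction. -/
theorem contDiffOn (H : IsEuler κ h h₁) : ContDiffOn ℝ ∞ h {0}ᶜ ∧ ContDiffOn ℝ ∞ h₁ {0}ᶜ := by
  have ho : IsOpen ({0}ᶜ : Set ℝ) := isOpen_compl_singleton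
  have key : ∀ n : ℕ, ContDiffOn ℝ n h {0}ᶜ ∧ ContDiffOn ℝ n h₁ {0}ᶜ := by
    intro n
    induction n with
    | zero =>
      refine ⟨contDiffOn_zero.2 fun p hp => ?_, contDiffOn_zero.2 fun p hp => ?_⟩
      · exact (H.fst p hp).continuousAt.continuousWithinAt
      · exact (H.snd p hp).continuousAt.continuousWithinAt
    | succ n ih =>
      have hid : ContDiffOn ℝ n (fun p : ℝ => p) {0}ᶜ := contDiffOn_id
      rw [Nat.cast_succ, contDiffOn_succ_iff_deriv_of_isOpen ho,
        contDiffOn_succ_iff_deriv_of_isOpen ho]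
      refine ⟨⟨fun p hp => (H.fst p hp).differentiableAt.differentiableWithinAt, by simp, ?_⟩,
        ⟨fun p hp => (H.snd p hp).differentiableAt.differentiableWithinAt, by simp, ?_⟩⟩
      · exact (ih.2.div hid fun p hp => hp).congr fun p hp => (H.fst p hp).deriv
      · exact ((contDiffOn_const.mul ih.1).div hid fun p hp => hp).congr
          fun p hp => (H.snd p hp).deriv
  exact ⟨contDiffOn_infty.2 fun n => (key n).1, contDiffOn_infty.2 fun n => (key n).2⟩

/-- Since `Real.log p` is `log |p|`, this is `|p| ^ μ`, a solution on both half-lines at once. -/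
theorem exp (μ : ℝ) : IsEuler (μ ^ 2) (fun p => Real.exp (μ * Real.log p))
    (fun p => μ * Real.exp (μ * Real.log p)) := by
  have h : ∀ p : ℝ, p ≠ 0 → HasDerivAt (fun p => Real.exp (μ * Real.log p))
      (μ * Real.exp (μ * Real.log p) / p) p := fun p hp => by
    refine HasDerivAt.congr_deriv (((Real.hasDerivAt_log hp).const_mul μ).exp) ?_
    field_simp
  refine ⟨h, fun p hp => ?_⟩
  refine HasDerivAt.congr_deriv ((h p hp).const_mul μ) ?_
  ring

end IsEuler

/-- `(C, S)` is a fundamental system of `p (p h')' = κ h`, normalised like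
`(cosh, sinh)` in `log |p|`. -/
structure IsEulerSystem (κ : ℝ) (C S : ℝ → ℝ) : Prop where
  fst : IsEuler κ C (fun p => κ * S p)
  snd : IsEuler κ S C
  wronskian : ∀ p, C p ^ 2 - κ * S p ^ 2 = 1

theorem isEulerSystem_exp {μ : ℝ} (hμ : μ ≠ 0) : IsEulerSystem (μ ^ 2)
    (fun p => 1 / 2 * Real.exp (μ * Real.log p) + 1 / 2 * Real.exp (-μ * Real.log p))
    (fun p => 1 / (2 * μ) * Real.exp (μ * Real.log p)
      + -1 / (2 * μ) * Real.exp (-μ * Real.log p)) := by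
  have h1 := IsEuler.exp μ
  have h2 := IsEuler.exp (-μ)
  rw [neg_sq] at h2
  refine ⟨?_, ?_, fun p => ?_⟩
  · convert h1.linearCombination h2 (1 / 2) (1 / 2) using 2 with p
    field_simp
  · convert h1.linearCombination h2 (1 / (2 * μ)) (-1 / (2 * μ)) using 2 with p
    field_simp
  · have h : Real.exp (μ * Real.log p) * Real.exp (-μ * Real.log p) = 1 := by
      rw [← Real.exp_add]; simp
    simp only [neg_mul] at h ⊢
    field_simp
    linear_combination 4 * h

/-- Both signs of `κ = -1/m` occur: exponentials in `log |p|` for `κ > 0`, and sine and cosine for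
`κ < 0`. -/
theorem exists_isEulerSystem {κ : ℝ} (hκ : κ ≠ 0) : ∃ C S, IsEulerSystem κ C S := by
  rcases lt_or_gt_of_ne hκ with h | h
  · have hν : Real.sqrt (-κ) ≠ 0 := (Real.sqrt_pos.2 (by linarith)).ne'
    have hsq : Real.sqrt (-κ) ^ 2 = -κ := Real.sq_sqrt (by linarith)
    set ν := Real.sqrt (-κ)
    have hκν : κ = -ν ^ 2 := by linarith
    have hl : ∀ p : ℝ, p ≠ 0 → HasDerivAt (fun p => ν * Real.log p) (ν * p⁻¹) p :=
      fun p hp => (Real.hasDerivAt_log hp).const_mul ν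
    refine ⟨fun p => Real.cos (ν * Real.log p), fun p => Real.sin (ν * Real.log p) / ν,
      ⟨fun p hp => ?_, fun p hp => ?_⟩, ⟨fun p hp => ?_, fun p hp => ?_⟩, fun p => ?_⟩
    · refine (hl p hp).cos.congr_deriv ?_
      rw [hκν]; field_simp
    · refine (((hl p hp).sin.div_const ν).const_mul κ).congr_deriv ?_
      field_simp
    · refine ((hl p hp).sin.div_const ν).congr_deriv ?_
      field_simp
    · refine (hl p hp).cos.congr_deriv ?_
      rw [hκν]; field_simp
    · rw [hκν]; field_simp
      linarith [Real.sin_sq_add_cos_sq (ν * Real.log p)]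
  · have := isEulerSystem_exp (Real.sqrt_pos.2 h).ne'
    rw [Real.sq_sqrt h.le] at this
    exact ⟨_, _, this⟩

/-- If `dh = (h₁ / q) dq` and `dh₁ = (κ h / q) dq` on a connected open set, then `h` is a fixed
solution of the Euler equation in the variable `q`. -/
theorem IsEulerSystem.exists_coeff {E : Type*} [NormedAddCommGroup E] [NormedSpace ℝ E]
    {κ : ℝ} {C S : ℝ → ℝ} (hCS : IsEulerSystem κ C S) {V : Set E} (hV : IsOpen V)
    (hc : IsPreconnected V) {q h h₁ : E → ℝ} (hq0 : ∀ P ∈ V, q P ≠ 0)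
    (hq : ∀ P ∈ V, DifferentiableAt ℝ q P)
    (hh : ∀ P ∈ V, HasFDerivAt h ((h₁ P / q P) • fderiv ℝ q P) P)
    (hh₁ : ∀ P ∈ V, HasFDerivAt h₁ ((κ * h P / q P) • fderiv ℝ q P) P) :
    ∃ a b : ℝ, ∀ P ∈ V, h P = a * C (q P) + b * S (q P) ∧
      h₁ P = a * (κ * S (q P)) + b * C (q P) := by
  have hC : ∀ P ∈ V, HasFDerivAt (fun P => C (q P)) ((κ * S (q P) / q P) • fderiv ℝ q P) P :=
    fun P hP => (hCS.fst.fst _ (hq0 P hP)).comp_hasFDerivAt P (hq P hP).hasFDerivAt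
  have hS : ∀ P ∈ V, HasFDerivAt (fun P => S (q P)) ((C (q P) / q P) • fderiv ℝ q P) P :=
    fun P hP => (hCS.snd.fst _ (hq0 P hP)).comp_hasFDerivAt P (hq P hP).hasFDerivAt
  -- Variation of constants: the inverse of the fundamental matrix, of determinant 1 by `wronskian`,
  -- is applied to `(h, h₁)`. The two resulting functions have zero differential, so they are
  -- constant on the connected set; no convexity of `V` is needed.
  have ha : ∀ P ∈ V, HasFDerivAt (fun P => C (q P) * h P - S (q P) * h₁ P) (0 : E →L[ℝ] ℝ) P := by
    intro P hP
    refine HasFDerivAt.congr_fderiv (((hC P hP).mul (hh P hP)).sub ((hS P hP).mul (hh₁ P hP))) ?_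
    ext v
    simp
    ring
  have hb : ∀ P ∈ V, HasFDerivAt (fun P => C (q P) * h₁ P - κ * (S (q P) * h P))
      (0 : E →L[ℝ] ℝ) P := by
    intro P hP
    refine HasFDerivAt.congr_fderiv (((hC P hP).mul (hh₁ P hP)).sub (((hS P hP).mul (hh P hP)).const_mul κ)) ?_
    ext v
    simp
    ring
  obtain ⟨a, ha'⟩ := hV.exists_is_const_of_fderiv_eq_zero hc
    (fun P hP => (ha P hP).differentiableAt.differentiableWithinAt) fun P hP => (ha P hP).fderiv
  obtain ⟨b, hb'⟩ := hV.exists_is_const_of_fderiv_eq_zero hc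
    (fun P hP => (hb P hP).differentiableAt.differentiableWithinAt) fun P hP => (hb P hP).fderiv
  refine ⟨a, b, fun P hP => ?_⟩
  have hw := hCS.wronskian (q P)
  rw [← ha' P hP, ← hb' P hP]
  constructor
  · linear_combination (-h P) * hw
  · linear_combination (-h₁ P) * hw

/-! ### Functions that are affine in `y` -/

/-- On `V`, the function `F` is affine with slope `a` along vertical translations. -/
def AffineInY (V : Set Jet) (F : Jet → ℝ) (a : ℝ) : Prop :=
  ∀ R ∈ V, ∀ t : ℝ, R + (0, t, 0) ∈ V → F (R + (0, t, 0)) = F R + t * a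

theorem eventually_vertical_mem {V : Set Jet} (hV : IsOpen V) {R : Jet} (hR : R ∈ V) :
    ∀ᶠ t : ℝ in nhds 0, R + (0, t, 0) ∈ V := by
  have hc : Continuous fun t : ℝ => R + ((0, t, 0) : Jet) := by fun_prop
  exact hc.continuousAt.eventually_mem (hV.mem_nhds (by simpa [← Prod.zero_eq_mk] using hR))

theorem AffineInY.dy_eq {V : Set Jet} (hV : IsOpen V) {F : Jet → ℝ} {a : ℝ}
    (hF : AffineInY V F a) {R : Jet} (hR : R ∈ V) (hd : DifferentiableAt ℝ F R) :
    dy F R = a := by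
  unfold dy
  rw [← hd.lineDeriv_eq_fderiv, lineDeriv]
  have h : (fun t : ℝ => F (R + t • ((0, 1, 0) : Jet))) =ᶠ[nhds 0] fun t => F R + t * a := by
    filter_upwards [eventually_vertical_mem hV hR] with t ht
    simpa using hF R hR t ht
  rw [h.deriv_eq]
  simp

theorem AffineInY.fderiv_apply {V : Set Jet} (hV : IsOpen V) {F : Jet → ℝ} {a : ℝ}
    (hF : AffineInY V F a) (v : Jet) : AffineInY V (fun P => fderiv ℝ F P v) 0 := by
  intro R hR t ht
  have hc : Continuous fun P : Jet => P + ((0, t, 0) : Jet) := by fun_prop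
  have h : (fun P => F (P + (0, t, 0))) =ᶠ[nhds R] fun P => F P + t * a := by
    filter_upwards [hV.mem_nhds hR, hc.continuousAt.eventually_mem (hV.mem_nhds ht)] with P hP hP'
    exact hF P hP t hP'
  have h' := h.fderiv_eq (𝕜 := ℝ)
  rw [fderiv_comp_add_right, fderiv_add_const] at h'
  simp [h']

/-- With `w` the value of `W` at `R`, the parameter `u` is the value of `W` at the shifted point.
This supplies the infinitely many zeros for `quadratic_coeff_eq_zero`. -/
theorem infinite_vertical {V : Set Jet} (hV : IsOpen V) {R : Jet} (hR : R ∈ V) (w : ℝ) :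
    {u : ℝ | R + (0, u - w, 0) ∈ V}.Infinite := by
  have hc : Continuous fun u : ℝ => R + ((0, u - w, 0) : Jet) := by fun_prop
  exact infinite_of_mem_nhds w (hc.continuousAt.preimage_mem_nhds
    (hV.mem_nhds (by simpa [← Prod.zero_eq_mk] using hR)))

/-! ### The right-hand side of the family -/

theorem fderiv_familyODE_rhs {m : ℝ} {P : Jet} (hP : P ∈ (familyODE m).dom) (v : Jet) :
    fderiv ℝ (familyODE m).rhs P v = 2 * m * P.2.2 * v.2.2 / (P.2.1 - (m + 1) * P.1 * P.2.2)
      - m * P.2.2 ^ 2 * (v.2.1 - (m + 1) * (v.1 * P.2.2 + P.1 * v.2.2))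
        / (P.2.1 - (m + 1) * P.1 * P.2.2) ^ 2 := by
  have hP' : P.2.1 - (m + 1) * P.1 * P.2.2 ≠ 0 := hP
  have hx : HasFDerivAt (fun P : Jet => P.1) (ContinuousLinearMap.fst ℝ ℝ (ℝ × ℝ)) P :=
    hasFDerivAt_fst
  have h2 : HasFDerivAt (fun P : Jet => P.2) (ContinuousLinearMap.snd ℝ ℝ (ℝ × ℝ)) P :=
    hasFDerivAt_snd
  have hy := h2.fst
  have hp := h2.snd
  have h := ((hp.pow 2).const_mul m).real_div (hy.sub ((hx.const_mul (m + 1)).mul hp)) hP'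
  have he : (familyODE m).rhs = fun P : Jet => m * P.2.2 ^ 2 /
    (P.2.1 - (m + 1) * P.1 * P.2.2) := rfl
  rw [he, HasFDerivAt.fderiv (f := fun P : Jet => m * P.2.2 ^ 2 /
    (P.2.1 - (m + 1) * P.1 * P.2.2)) h]
  simp
  field_simp
  ring

/-- Numerator and denominator are both multiplied by `-1/4`. Where the denominator vanishes, both
quotients are 0 by convention, so the two structures agree also off the domain. -/
theorem mainODE_eq : mainODE = familyODE (-1 / 4) := by
  have h : ∀ P : Jet, P.2.1 - (-1 / 4 + 1) * P.1 * P.2.2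
      = -(1 / 4) * (3 * P.1 * P.2.2 - 4 * P.2.1) := fun P => by ring
  unfold mainODE familyODE
  congr 1
  · ext P
    simp [h]
  · funext P
    rw [h]
    by_cases h0 : 3 * P.1 * P.2.2 - 4 * P.2.1 = 0
    · simp [h0]
    · field_simp

/-! ### Generators -/

/-- As `Q_y` is constant, symmetry of second derivatives kills `Q_xy` and `Q_py`; only `Q_xx`,
`Q_xp` and `Q_pp` survive in `D η⁽¹⁾ - ω D ξ`. -/
theorem linearizedSymmetryAt_iff {O : ODE2} {V : Set Jet} (hV : IsOpen V) {Q : Jet → ℝ} {c : ℝ}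
    (hQ : ContDiffOn ℝ ∞ Q V) (hy : ∀ P ∈ V, dy Q P = c) {X : Jet → Jet}
    (hX : ∀ P ∈ V, X P = contactField Q P) {P : Jet} (hP : P ∈ V) :
    O.LinearizedSymmetryAt X P ↔ (P ∈ O.dom →
      dx (dx Q) P + O.rhs P * (2 * dp (dx Q) P + c) + O.rhs P ^ 2 * dp (dp Q) P
        = fderiv ℝ O.rhs P (X P)) := by
  have hQP : ContDiffAt ℝ ∞ Q P := hQ.contDiffAt (hV.mem_nhds hP)
  have hdx : DifferentiableAt ℝ (dx Q) P :=
    ((contDiffOn_fderiv_apply hV hQ _).contDiffAt (hV.mem_nhds hP)).differentiableAt (by simp)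
  have hdp : DifferentiableAt ℝ (dp Q) P :=
    ((contDiffOn_fderiv_apply hV hQ _).contDiffAt (hV.mem_nhds hP)).differentiableAt (by simp)
  have hyE : dy Q =ᶠ[nhds P] fun _ => c := by
    filter_upwards [hV.mem_nhds hP] with R hR using hy R hR
  have hyx : dy (dx Q) P = 0 := by
    have := fderiv_fderiv_apply_comm hQP (1, 0, 0) (0, 1, 0)
    change fderiv ℝ (dx Q) P (0, 1, 0) = fderiv ℝ (dy Q) P (1, 0, 0) at this
    rw [dy, this, hyE.fderiv_eq]
    simp
  have hyp : dy (dp Q) P = 0 := by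
    have := fderiv_fderiv_apply_comm hQP (0, 0, 1) (0, 1, 0)
    change fderiv ℝ (dp Q) P (0, 1, 0) = fderiv ℝ (dy Q) P (0, 0, 1) at this
    rw [dy, this, hyE.fderiv_eq]
    simp
  have hxp : dx (dp Q) P = dp (dx Q) P := fderiv_fderiv_apply_comm hQP (0, 0, 1) (1, 0, 0)
  have h1 : fderiv ℝ (fun R => (X R).2.2) P
      = fderiv ℝ (dx Q) P + c • fderiv ℝ (fun R : Jet => R.2.2) P := by
    have : (fun R => (X R).2.2) =ᶠ[nhds P] fun R => dx Q R + c • R.2.2 := by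
      filter_upwards [hV.mem_nhds hP] with R hR
      simp [hX R hR, contactField, hy R hR, mul_comm]
    rw [this.fderiv_eq, fderiv_fun_add hdx (by fun_prop), fderiv_fun_const_smul (by fun_prop)]
  have h2 : fderiv ℝ (fun R => (X R).1) P = - fderiv ℝ (dp Q) P := by
    have : (fun R => (X R).1) =ᶠ[nhds P] fun R => - dp Q R := by
      filter_upwards [hV.mem_nhds hP] with R hR
      simp [hX R hR, contactField]
    rw [this.fderiv_eq, fderiv_fun_neg]
  have h3 : ∀ v : Jet, fderiv ℝ (fun R : Jet => R.2.2) P v = v.2.2 := by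
    intro v
    have h : HasFDerivAt (fun P : Jet => P.2) (ContinuousLinearMap.snd ℝ ℝ (ℝ × ℝ)) P :=
      hasFDerivAt_snd
    rw [h.snd.fderiv]
    simp
  have h4 : O.totalD (fun R => (X R).2.2) P - O.rhs P * O.totalD (fun R => (X R).1) P
      = dx (dx Q) P + O.rhs P * (2 * dp (dx Q) P + c) + O.rhs P ^ 2 * dp (dp Q) P := by
    unfold ODE2.totalD
    rw [h1, h2]
    simp only [add_apply, smul_apply,
      neg_apply, h3, fderiv_jet_apply, hyx, hyp, hxp, smul_eq_mul]
    ring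
  unfold ODE2.LinearizedSymmetryAt
  rw [h4]

/-- The contact field with characteristic function `c y + α x p + h(p)`, where `h₁ = p h'`. -/
def generatorField (c α : ℝ) (h h₁ : ℝ → ℝ) (P : Jet) : Jet :=
  (-(α * P.1) - h₁ P.2.2 / P.2.2, c * P.2.1 + h P.2.2 - h₁ P.2.2, (c + α) * P.2.2)

/-- The linearized symmetry condition of the family, split by powers of `y - (m + 1) x p`. -/
theorem determining_equations {m : ℝ} {V : Set Jet} (hV : IsOpen V)
    {Q : Jet → ℝ} {c : ℝ} (hQ : ContDiffOn ℝ ∞ Q V) (hc : AffineInY V Q c)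
    {X : Jet → Jet} (hX : ∀ P ∈ V, X P = contactField Q P)
    (hs : ∀ P ∈ V, (familyODE m).LinearizedSymmetryAt X P) {P : Jet} (hP : P ∈ V) :
    dx (dx Q) P = 0 ∧
    m * P.2.2 ^ 2 * (2 * dp (dx Q) P + c) - 2 * m * P.2.2 * (dx Q P + P.2.2 * c)
      + m * P.2.2 ^ 2 * c = 0 ∧
    m ^ 2 * P.2.2 ^ 4 * dp (dp Q) P + m * P.2.2 ^ 2 * (Q P
      - c * (P.2.1 - (m + 1) * P.1 * P.2.2) - P.2.2 * dp Q P
      - (m + 1) * (-dp Q P * P.2.2 + P.1 * (dx Q P + P.2.2 * c))) = 0 := by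
  have hd : ∀ P ∈ V, DifferentiableAt ℝ Q P := fun P hP =>
    (hQ.contDiffAt (hV.mem_nhds hP)).differentiableAt (by simp)
  have hy : ∀ P ∈ V, dy Q P = c := fun P hP => hc.dy_eq hV hP (hd P hP)
  -- Along the vertical line through `P` the derivatives of `Q` are constant, `Q` is affine in `u`,
  -- and `ω = m p² / u`. Multiplying the condition by `u²` gives a quadratic in `u`; only `u = 0` is
  -- excluded, hence `k = 1`, `T = 0`.
  refine quadratic_coeff_eq_zero (k := 1) (T := 0)
    (infinite_vertical hV hP (P.2.1 - (m + 1) * P.1 * P.2.2)) one_ne_zero fun u hu hu0 _ => ?_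
  set t := u - (P.2.1 - (m + 1) * P.1 * P.2.2) with ht
  have hu' : P + (0, t, 0) ∈ V := hu
  have hW : (P + (0, t, 0)).2.1 - (m + 1) * (P + (0, t, 0)).1 * (P + (0, t, 0)).2.2 = u := by
    simp [ht]
    ring
  have hdom : P + (0, t, 0) ∈ (familyODE m).dom := by
    change (P + (0, t, 0)).2.1 - (m + 1) * (P + (0, t, 0)).1 * (P + (0, t, 0)).2.2 ≠ 0
    rwa [hW]
  have h := (linearizedSymmetryAt_iff hV hQ hy hX hu').1 (hs _ hu') hdom
  rw [fderiv_familyODE_rhs hdom, hW, hX _ hu'] at h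
  have e1 := (hc.fderiv_apply hV (1, 0, 0)) P hP t hu'
  have e2 := (hc.fderiv_apply hV (0, 0, 1)) P hP t hu'
  have e3 := ((hc.fderiv_apply hV (1, 0, 0)).fderiv_apply hV (1, 0, 0)) P hP t hu'
  have e4 := ((hc.fderiv_apply hV (1, 0, 0)).fderiv_apply hV (0, 0, 1)) P hP t hu'
  have e5 := ((hc.fderiv_apply hV (0, 0, 1)).fderiv_apply hV (0, 0, 1)) P hP t hu'
  have e6 := hc P hP t hu'
  change dx Q _ = dx Q P + _ at e1
  change dp Q _ = dp Q P + _ at e2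
  change dx (dx Q) _ = dx (dx Q) P + _ at e3
  change dp (dx Q) _ = dp (dx Q) P + _ at e4
  change dp (dp Q) _ = dp (dp Q) P + _ at e5
  have hr : (familyODE m).rhs (P + (0, t, 0)) = m * P.2.2 ^ 2 / u := by
    change m * (P + (0, t, 0)).2.2 ^ 2 / _ = _
    rw [hW]; simp
  simp only [contactField, hy _ hu', e1, e2, e3, e4, e5, e6, hr] at h
  simp only [mul_zero, add_zero, Prod.snd_add, Prod.fst_add] at h
  field_simp at h
  rw [ht] at h
  linear_combination h

theorem exists_eq_generatorField {m : ℝ} (hm : m ≠ 0) {C S : ℝ → ℝ}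
    (hCS : IsEulerSystem (-1 / m) C S) {V : Set Jet} (hV : IsOpen V) (hVc : IsPreconnected V)
    (hVp : V ⊆ phase) {X : Jet → Jet} (hX : X ∈ (familyODE m).uniformGenerators V) :
    ∃ c α a b : ℝ, ∀ P ∈ V, X P = generatorField c α (fun p => a * C p + b * S p)
      (fun p => a * (-1 / m * S p) + b * C p) P := by
  obtain ⟨-, c, φ, hQ, hXQ, hs⟩ := hX
  set Q : Jet → ℝ := fun P => c * P.2.1 + φ P.1 P.2.2 with hQdef
  have hc : AffineInY V Q c := fun R _ t _ => by simp [hQdef]; ring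
  have hdet := fun P (hP : P ∈ V) => determining_equations hV hQ hc hXQ hs hP
  have hdQ : ∀ P ∈ V, DifferentiableAt ℝ Q P := fun P hP =>
    (hQ.contDiffAt (hV.mem_nhds hP)).differentiableAt (by simp)
  have hy : ∀ P ∈ V, dy Q P = c := fun P hP => hc.dy_eq hV hP (hdQ P hP)
  have hdx : ∀ P ∈ V, DifferentiableAt ℝ (dx Q) P := fun P hP =>
    ((contDiffOn_fderiv_apply hV hQ _).contDiffAt (hV.mem_nhds hP)).differentiableAt (by simp)
  have hdp : ∀ P ∈ V, DifferentiableAt ℝ (dp Q) P := fun P hP =>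
    ((contDiffOn_fderiv_apply hV hQ _).contDiffAt (hV.mem_nhds hP)).differentiableAt (by simp)
  have hyx : ∀ P ∈ V, dy (dx Q) P = 0 := fun P hP =>
    (hc.fderiv_apply hV (1, 0, 0)).dy_eq hV hP (hdx P hP)
  have hyp : ∀ P ∈ V, dy (dp Q) P = 0 := fun P hP =>
    (hc.fderiv_apply hV (0, 0, 1)).dy_eq hV hP (hdp P hP)
  have hx : ∀ P : Jet, HasFDerivAt (fun P : Jet => P.1) (ContinuousLinearMap.fst ℝ ℝ (ℝ × ℝ)) P :=
    fun P => hasFDerivAt_fst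
  have h2 : ∀ P : Jet, HasFDerivAt (fun P : Jet => P.2) (ContinuousLinearMap.snd ℝ ℝ (ℝ × ℝ)) P :=
    fun P => hasFDerivAt_snd
  have hpx : ∀ P ∈ V, P.2.2 * dp (dx Q) P = dx Q P := fun P hP => by
    have h := (hdet P hP).2.1
    have hp : P.2.2 ≠ 0 := hVp hP
    have : 2 * m * P.2.2 * (P.2.2 * dp (dx Q) P - dx Q P) = 0 := by linear_combination h
    have h0 : 2 * m * P.2.2 ≠ 0 := by positivity
    linarith [(mul_eq_zero.1 this).resolve_left h0]
  -- `Q_xx = Q_xy = 0` and `p Q_xp = Q_x` say that `Q_x / p` has zero differential.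
  obtain ⟨α, hα⟩ : ∃ α, ∀ P ∈ V, dx Q P / P.2.2 = α := by
    have hF : ∀ P ∈ V, HasFDerivAt (fun P : Jet => dx Q P / P.2.2) (0 : Jet →L[ℝ] ℝ) P := by
      intro P hP
      have hp : P.2.2 ≠ 0 := hVp hP
      refine ((hdx P hP).hasFDerivAt.real_div (h2 P).snd hp).congr_fderiv ?_
      have e1 := (hdet P hP).1
      have e2 := hyx P hP
      have e3 := hpx P hP
      refine fderiv_jet_ext ?_ ?_ ?_ <;> simp [fderiv_jet_apply, e1, e2, ← e3]
      field_simp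
      ring
    obtain ⟨α, h⟩ := hV.exists_is_const_of_fderiv_eq_zero hVc
      (fun P hP => (hF P hP).differentiableAt.differentiableWithinAt) fun P hP => (hF P hP).fderiv
    exact ⟨α, h⟩
  have hα' : ∀ P ∈ V, dx Q P = α * P.2.2 := fun P hP => by
    have hp : P.2.2 ≠ 0 := hVp hP
    rw [← hα P hP]; field_simp
  have hxp : ∀ P ∈ V, dx (dp Q) P = α := fun P hP => by
    have hp : P.2.2 ≠ 0 := hVp hP
    have h : dx (dp Q) P = dp (dx Q) P :=
      fderiv_fderiv_apply_comm (hQ.contDiffAt (hV.mem_nhds hP)) (0, 0, 1) (1, 0, 0)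
    rw [h, ← hα P hP, ← hpx P hP]; field_simp
  have hq : ∀ P : Jet, fderiv ℝ (fun P : Jet => P.2.2) P
      = (ContinuousLinearMap.snd ℝ ℝ ℝ).comp (ContinuousLinearMap.snd ℝ ℝ (ℝ × ℝ)) :=
    fun P => (h2 P).snd.fderiv
  -- The remainder `Q - c y - α x p` has a differential proportional to `dp`, and the third
  -- determining equation is the Euler equation for it.
  obtain ⟨a, b, hab⟩ := hCS.exists_coeff hV hVc (q := fun P : Jet => P.2.2)
    (h := fun P => Q P - c * P.2.1 - α * (P.1 * P.2.2))
    (h₁ := fun P => P.2.2 * dp Q P - α * (P.1 * P.2.2)) hVp (fun P _ => by fun_prop)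
    (fun P hP => by
      have hp : P.2.2 ≠ 0 := hVp hP
      refine (((hdQ P hP).hasFDerivAt.sub ((h2 P).fst.const_mul c)).sub
        (((hx P).mul (h2 P).snd).const_mul α)).congr_fderiv ?_
      rw [hq]
      have e1 := hα' P hP
      have e2 := hy P hP
      refine fderiv_jet_ext ?_ ?_ ?_ <;> simp [fderiv_jet_apply, e1, e2]
      field_simp)
    (fun P hP => by
      have hp : P.2.2 ≠ 0 := hVp hP
      refine (((h2 P).snd.mul (hdp P hP).hasFDerivAt).sub
        (((hx P).mul (h2 P).snd).const_mul α)).congr_fderiv ?_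
      rw [hq]
      have e1 := hxp P hP
      have e2 := hyp P hP
      have e3 := (hdet P hP).2.2
      rw [hα' P hP] at e3
      refine fderiv_jet_ext ?_ ?_ ?_ <;> simp [fderiv_jet_apply, e1, e2]
      · ring
      · have e4 : m * P.2.2 ^ 2 * (m * P.2.2 ^ 2 * dp (dp Q) P + m * P.2.2 * dp Q P
            + Q P - c * P.2.1 - (m + 1) * α * P.1 * P.2.2) = 0 := by linear_combination e3
        have h0 : m * P.2.2 ^ 2 ≠ 0 := by positivity
        have e5 := (mul_eq_zero.1 e4).resolve_left h0
        field_simp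
        linear_combination e5)
  refine ⟨c, α, a, b, fun P hP => ?_⟩
  have hp : P.2.2 ≠ 0 := hVp hP
  obtain ⟨h1, h2⟩ := hab P hP
  rw [hXQ P hP, contactField, generatorField, hy P hP, hα' P hP, ← h1, ← h2]
  refine Prod.ext ?_ (Prod.ext ?_ ?_)
  · simp only
    field_simp
    ring
  · simp only
    ring
  · simp only
    ring

theorem mem_uniformGenerators {m : ℝ} (hm : m ≠ 0) {h h₁ : ℝ → ℝ} (hh : IsEuler (-1 / m) h h₁)
    (c α : ℝ) {V : Set Jet} (hV : IsOpen V) (hVp : V ⊆ phase) {X : Jet → Jet}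
    (hX0 : ∀ P ∉ V, X P = 0) (hX : ∀ P ∈ V, X P = generatorField c α h h₁ P) :
    X ∈ (familyODE m).uniformGenerators V := by
  have hQ : ContDiffOn ℝ ∞ (fun P : Jet => c * P.2.1 + (α * P.1 * P.2.2 + h P.2.2)) V := by
    have hh' : ContDiffOn ℝ ∞ (fun P : Jet => h P.2.2) V :=
      hh.contDiffOn.1.comp (g := h) (f := fun P : Jet => P.2.2) (by fun_prop) hVp
    have h1 : ContDiffOn ℝ ∞ (fun P : Jet => c * P.2.1 + α * P.1 * P.2.2) V := by fun_prop
    refine (h1.add hh').congr fun P _ => ?_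
    ring
  set Q : Jet → ℝ := fun P => c * P.2.1 + (α * P.1 * P.2.2 + h P.2.2) with hQdef
  have hx : ∀ P : Jet, HasFDerivAt (fun P : Jet => P.1) (ContinuousLinearMap.fst ℝ ℝ (ℝ × ℝ)) P :=
    fun P => hasFDerivAt_fst
  have h2 : ∀ P : Jet, HasFDerivAt (fun P : Jet => P.2) (ContinuousLinearMap.snd ℝ ℝ (ℝ × ℝ)) P :=
    fun P => hasFDerivAt_snd
  have hQd : ∀ P ∈ V, HasFDerivAt Q _ P := fun P hP =>
    ((h2 P).fst.const_mul c).add ((((hx P).const_mul α).mul (h2 P).snd).add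
      ((hh.fst P.2.2 (hVp hP)).comp_hasFDerivAt P (h2 P).snd))
  have hdx : ∀ P ∈ V, dx Q P = α * P.2.2 := fun P hP => by
    rw [dx, (hQd P hP).fderiv]; simp; ring
  have hdy : ∀ P ∈ V, dy Q P = c := fun P hP => by
    rw [dy, (hQd P hP).fderiv]; simp
  have hdp : ∀ P ∈ V, dp Q P = α * P.1 + h₁ P.2.2 / P.2.2 := fun P hP => by
    rw [dp, (hQd P hP).fderiv]; simp
  have hXQ : ∀ P ∈ V, X P = contactField Q P := fun P hP => by
    have hp : P.2.2 ≠ 0 := hVp hP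
    rw [hX P hP, contactField, generatorField, hdx P hP, hdy P hP, hdp P hP]
    refine Prod.ext ?_ (Prod.ext ?_ ?_)
    · simp only
      ring
    · simp only [hQdef]
      field_simp
      ring
    · simp only
      ring
  refine ⟨hX0, c, fun x p => α * x * p + h p, hQ, hXQ, fun P hP => ?_⟩
  rw [linearizedSymmetryAt_iff hV hQ hdy hXQ hP]
  intro hdom
  have hp : P.2.2 ≠ 0 := hVp hP
  have hdxE : dx Q =ᶠ[nhds P] fun P => α * P.2.2 := by
    filter_upwards [hV.mem_nhds hP] with R hR using hdx R hR
  have hdpE : dp Q =ᶠ[nhds P] fun P => α * P.1 + h₁ P.2.2 / P.2.2 := by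
    filter_upwards [hV.mem_nhds hP] with R hR using hdp R hR
  have hdxx := hdxE.fderiv_eq.trans ((h2 P).snd.const_mul α).fderiv
  have hdpp := hdpE.fderiv_eq.trans (((hx P).const_mul α).add
    (((hh.snd P.2.2 hp).comp_hasFDerivAt P (h2 P).snd).real_div (h2 P).snd hp)).fderiv
  rw [fderiv_familyODE_rhs hdom, dx, dp, dp, hdxx, hdpp, hX P hP]
  have hP' : P.2.1 - (m + 1) * P.1 * P.2.2 ≠ 0 := hdom
  change _ + m * P.2.2 ^ 2 / (P.2.1 - (m + 1) * P.1 * P.2.2) * _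
    + (m * P.2.2 ^ 2 / (P.2.1 - (m + 1) * P.1 * P.2.2)) ^ 2 * _ = _
  simp [generatorField]
  field_simp
  ring

/-! ### The Lie algebra of generators -/

theorem fderiv_generatorField {κ : ℝ} {h h₁ : ℝ → ℝ} (hh : IsEuler κ h h₁) (c α : ℝ) {P : Jet}
    (hP : P ∈ phase) (v : Jet) :
    fderiv ℝ (generatorField c α h h₁) P v =
      (-(α * v.1) - (κ * h P.2.2 - h₁ P.2.2) / P.2.2 ^ 2 * v.2.2,
        c * v.2.1 + (h₁ P.2.2 - κ * h P.2.2) / P.2.2 * v.2.2, (c + α) * v.2.2) := by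
  have hp : P.2.2 ≠ 0 := hP
  have hx : HasFDerivAt (fun P : Jet => P.1) (ContinuousLinearMap.fst ℝ ℝ (ℝ × ℝ)) P :=
    hasFDerivAt_fst
  have h2 : HasFDerivAt (fun P : Jet => P.2) (ContinuousLinearMap.snd ℝ ℝ (ℝ × ℝ)) P :=
    hasFDerivAt_snd
  have e := (hh.fst P.2.2 hp).comp_hasFDerivAt P h2.snd
  have e₁ := (hh.snd P.2.2 hp).comp_hasFDerivAt P h2.snd
  have H := ((hx.const_mul α).neg.sub (e₁.real_div h2.snd hp)).prodMk
    ((((h2.fst.const_mul c).add e).sub e₁).prodMk (h2.snd.const_mul (c + α)))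
  rw [HasFDerivAt.fderiv (f := generatorField c α h h₁) H]
  refine Prod.ext ?_ (Prod.ext ?_ ?_)
  · simp
    field_simp
  · simp
    field_simp
    ring
  · simp

/-- Scalings commute with each other, as do translations, so the bracket is a translation; a scaling
acts on Euler solutions through `h ↦ c' h - (c' + α') p h'`. -/
theorem lieBracket_generatorField {κ : ℝ} {h h₁ g g₁ : ℝ → ℝ} (hh : IsEuler κ h h₁)
    (hg : IsEuler κ g g₁) (c α c' α' : ℝ) {P : Jet} (hP : P ∈ phase) :
    VectorField.lieBracket ℝ (generatorField c α h h₁) (generatorField c' α' g g₁) P =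
      generatorField 0 0
        (fun p => (c' * h p - (c' + α') * h₁ p) - (c * g p - (c + α) * g₁ p))
        (fun p => (c' * h₁ p - (c' + α') * (κ * h p)) - (c * g₁ p - (c + α) * (κ * g p))) P := by
  have hp : P.2.2 ≠ 0 := hP
  rw [VectorField.lieBracket, fderiv_generatorField hh c α hP, fderiv_generatorField hg c' α' hP]
  refine Prod.ext ?_ (Prod.ext ?_ ?_)
  · simp [generatorField]
    field_simp
    ring
  · simp [generatorField]
    field_simp
    ring
  · simp [generatorField]
    ring

theorem lieBracket_indicator {V : Set Jet} (hV : IsOpen V) (X Y : Jet → Jet) :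
    VectorField.lieBracket ℝ (V.indicator X) (V.indicator Y)
      = V.indicator (VectorField.lieBracket ℝ X Y) := by
  funext P
  by_cases hP : P ∈ V
  · rw [Set.indicator_of_mem hP]
    have hX : V.indicator X =ᶠ[nhds P] X := by
      filter_upwards [hV.mem_nhds hP] with R hR using Set.indicator_of_mem hR X
    have hY : V.indicator Y =ᶠ[nhds P] Y := by
      filter_upwards [hV.mem_nhds hP] with R hR using Set.indicator_of_mem hR Y
    simp only [VectorField.lieBracket, hX.fderiv_eq, hY.fderiv_eq, hX.eq_of_nhds, hY.eq_of_nhds]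
  · simp [VectorField.lieBracket, Set.indicator_of_notMem hP]

/-- The generator with coordinates `u` in the basis with characteristic functions `-|p| ^ μ`,
`y / 2 - (1 / (2 μ) + 1 / 2) x p`, `|p| ^ (-μ)`, `y / 2 + (1 / (2 μ) - 1 / 2) x p`. -/
def powerGenerator (μ : ℝ) (u : A1 × A1) : Jet → Jet :=
  generatorField ((u.1.snd + u.2.snd) / 2)
    (-((u.1.snd + u.2.snd) / 2) + (u.2.snd - u.1.snd) / (2 * μ))
    (fun p => -u.1.fst * Real.exp (μ * Real.log p) + u.2.fst * Real.exp (-μ * Real.log p))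
    (fun p => -u.1.fst * (μ * Real.exp (μ * Real.log p))
      + u.2.fst * (-μ * Real.exp (-μ * Real.log p)))

theorem isEuler_powerGenerator (μ a b : ℝ) : IsEuler (μ ^ 2)
    (fun p => a * Real.exp (μ * Real.log p) + b * Real.exp (-μ * Real.log p))
    (fun p => a * (μ * Real.exp (μ * Real.log p)) + b * (-μ * Real.exp (-μ * Real.log p))) := by
  have h := IsEuler.exp (-μ)
  rw [neg_sq] at h
  exact (IsEuler.exp μ).linearCombination h a b

/-- The linear map sending coordinates to generators on `V`, extended by zero. -/
def powerGeneratorMap (μ : ℝ) (V : Set Jet) : (A1 × A1) →ₗ[ℝ] (Jet → Jet) where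
  toFun u := V.indicator (powerGenerator μ u)
  map_add' u v := by
    funext P
    by_cases hP : P ∉ V
    · simp [hP]
    rw [not_not] at hP
    simp only [Pi.add_apply, Set.indicator_of_mem hP]
    refine Prod.ext ?_ (Prod.ext ?_ ?_) <;> simp [powerGenerator, generatorField] <;> ring
  map_smul' t u := by
    funext P
    by_cases hP : P ∉ V
    · simp [hP]
    rw [not_not] at hP
    simp only [RingHom.id_apply, Pi.smul_apply, Set.indicator_of_mem hP]
    refine Prod.ext ?_ (Prod.ext ?_ ?_) <;> simp [powerGenerator, generatorField] <;> ring

theorem powerGeneratorMap_apply {μ : ℝ} {V : Set Jet} {P : Jet} (hP : P ∈ V) (u : A1 × A1) :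
    powerGeneratorMap μ V u P = powerGenerator μ u P :=
  Set.indicator_of_mem hP _

/-- The functions `|p| ^ (±μ)` are eigenvectors of `p d/dp`. The two scalings have `c = 1/2` and `c
+ α = ∓1/(2μ)`, so each acts as 1 on one of these functions and as 0 on the other: the bracket of
two copies of `𝔞(1)`. -/
theorem isGeneratorIso_powerGeneratorMap {m μ : ℝ} (hμ : μ ≠ 0) (hm : m = -1 / μ ^ 2)
    {V : Set Jet} (hV : IsOpen V) (hVc : IsConnected V) (hVp : V ⊆ phase) :
    (familyODE m).IsGeneratorIso V (powerGeneratorMap μ V) := by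
  have hm0 : m ≠ 0 := by rw [hm]; positivity
  have hκ : -1 / m = μ ^ 2 := by rw [hm]; field_simp
  constructor
  · rw [← LinearMap.ker_eq_bot, LinearMap.ker_eq_bot']
    intro u hu
    obtain ⟨P, hP⟩ := hVc.nonempty
    have hp : P.2.2 ≠ 0 := hVp hP
    have key : ∀ R ∈ V, powerGenerator μ u R = 0 := fun R hR => by
      rw [← powerGeneratorMap_apply hR, hu]; rfl
    -- A second point on the same vertical line separates `c y` from the part depending on `p`
    -- alone.
    obtain ⟨t, ht, ht0⟩ : ∃ t : ℝ, P + (0, t, 0) ∈ V ∧ t ≠ 0 := by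
      have h := (eventually_vertical_mem hV hP).filter_mono (nhdsWithin_le_nhds (s := {0}ᶜ))
      exact (h.and self_mem_nhdsWithin).exists
    have k0 := key P hP
    have k1 := key _ ht
    simp only [powerGenerator, generatorField, Prod.mk_eq_zero, Prod.fst_add, Prod.snd_add,
      add_zero] at k0 k1
    obtain ⟨a0, b0, c0⟩ := k0
    obtain ⟨a1, b1, c1⟩ := k1
    have hd : u.2.snd - u.1.snd = 0 := by
      have := (mul_eq_zero.1 c0).resolve_right hp
      field_simp at this
      linarith
    have hc : u.1.snd + u.2.snd = 0 := by
      have : (u.1.snd + u.2.snd) * t = 0 := by linarith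
      exact (mul_eq_zero.1 this).resolve_right ht0
    have hp1 := Real.exp_pos (μ * Real.log P.2.2)
    have hp2 := Real.exp_pos (-μ * Real.log P.2.2)
    generalize Real.exp (μ * Real.log P.2.2) = E at *
    generalize Real.exp (-μ * Real.log P.2.2) = F at *
    have hs : u.1.fst * E + u.2.fst * F = 0 := by
      simp only [hd, hc] at a0
      have : μ * (u.1.fst * E + u.2.fst * F) / P.2.2 = 0 := by linear_combination a0
      exact (mul_eq_zero.1 ((div_eq_zero_iff.1 this).resolve_right hp)).resolve_left hμ
    rw [hc] at b0
    have h1 : u.1.fst * E = 0 := by linear_combination (1 + μ) / 2 * hs - 1 / 2 * b0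
    have h2 : u.2.fst * F = 0 := by linear_combination (1 - μ) / 2 * hs + 1 / 2 * b0
    have h1' := (mul_eq_zero.1 h1).resolve_right hp1.ne'
    have h2' := (mul_eq_zero.1 h2).resolve_right hp2.ne'
    refine Prod.ext (A1.ext h1' ?_) (A1.ext h2' ?_)
    · simp; linarith
    · simp; linarith
  · apply Set.Subset.antisymm
    · rintro _ ⟨u, rfl⟩
      have h := isEuler_powerGenerator μ (-u.1.fst) u.2.fst
      rw [← hκ] at h
      exact mem_uniformGenerators hm0 h _ _ hV hVp
        (fun P hP => Set.indicator_of_notMem hP _) fun P hP => Set.indicator_of_mem hP _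
    · intro X hX
      have hCS := isEulerSystem_exp hμ
      rw [← hκ] at hCS
      obtain ⟨c, α, a, b, h⟩ := exists_eq_generatorField hm0 hCS hV hVc.isPreconnected hVp hX
      -- The first entries expand `a C + b S` in exponentials; the second entries solve `(u₁ + u₂) /
      -- 2 = c` and `(u₂ - u₁) / (2 μ) = c + α`.
      refine ⟨(⟨-(a / 2 + b / (2 * μ)), c - μ * (α + c)⟩,
        ⟨a / 2 - b / (2 * μ), c + μ * (α + c)⟩), ?_⟩
      funext P
      by_cases hP : P ∈ V
      · rw [powerGeneratorMap_apply hP, h P hP, hκ]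
        refine Prod.ext ?_ (Prod.ext ?_ ?_) <;> simp [powerGenerator, generatorField]
        · field_simp
          ring
        · field_simp
          ring
        · left
          field_simp
          ring
      · rw [hX.1 P hP]
        exact Set.indicator_of_notMem hP _
  · intro u v
    change V.indicator _ = VectorField.lieBracket ℝ (V.indicator _) (V.indicator _)
    rw [lieBracket_indicator hV]
    funext P
    by_cases hP : P ∈ V
    · have hp : P.2.2 ≠ 0 := hVp hP
      rw [Set.indicator_of_mem hP, Set.indicator_of_mem hP]
      unfold powerGenerator
      rw [lieBracket_generatorField (isEuler_powerGenerator μ _ _) (isEuler_powerGenerator μ _ _)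
        _ _ _ _ (hVp hP)]
      refine Prod.ext ?_ (Prod.ext ?_ ?_) <;> simp [generatorField]
      · field_simp
        ring
      · field_simp
        ring
    · rw [Set.indicator_of_notMem hP, Set.indicator_of_notMem hP]

theorem familyODE_generators {m : ℝ} (hm : m < 0) {V : Set Jet} (hV : IsOpen V)
    (hVc : IsConnected V) (hVp : V ⊆ phase) :
    ∃ e : (A1 × A1) →ₗ[ℝ] (Jet → Jet), (familyODE m).IsGeneratorIso V e := by
  have h : 0 < -1 / m := div_pos_of_neg_of_neg (by norm_num) hm
  refine ⟨_, isGeneratorIso_powerGeneratorMap (Real.sqrt_pos.2 h).ne' ?_ hV hVc hVp⟩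
  rw [Real.sq_sqrt h.le]
  field_simp

theorem mainODE_generators {V : Set Jet} (hV : IsOpen V) (hVc : IsConnected V)
    (hVp : V ⊆ phase) :
    ∃ e : (A1 × A1) →ₗ[ℝ] (Jet → Jet), mainODE.IsGeneratorIso V e ∧
      ∀ P ∈ V, e (A1.e₁, 0) P = X₁ P ∧ e (A1.e₂, 0) P = X₂ P ∧
        e (0, A1.e₁) P = X₃ P ∧ e (0, A1.e₂) P = X₄ P := by
  refine ⟨powerGeneratorMap 2 V, ?_, fun P hP => ?_⟩
  · rw [mainODE_eq]
    exact isGeneratorIso_powerGeneratorMap two_ne_zero (by norm_num) hV hVc hVp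
  have hp : P.2.2 ≠ 0 := hVp hP
  have h2 : Real.exp (2 * Real.log P.2.2) = P.2.2 ^ 2 := by
    rw [two_mul, Real.exp_add, Real.exp_log_eq_abs hp, abs_mul_abs_self, sq]
  have h3 : Real.exp (-2 * Real.log P.2.2) = (P.2.2 ^ 2)⁻¹ := by
    rw [neg_mul, Real.exp_neg, h2]
  simp only [powerGeneratorMap_apply hP, powerGenerator, generatorField, h2, h3, X₁, X₂, X₃, X₄,
    A1.e₁, A1.e₂]
  refine ⟨?_, ?_, ?_, ?_⟩ <;> refine Prod.ext ?_ (Prod.ext ?_ ?_) <;> simp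
      <;> field_simp <;> first | ring1 | (left; ring1)

/-! ### The discrete group -/

theorem isOpen_phase : IsOpen phase :=
  isOpen_ne_fun (by fun_prop : Continuous fun P : Jet => P.2.2) continuous_const

/-- The coordinate `z = x p`. -/
def zCoord (P : Jet) : ℝ := P.1 * P.2.2

/-- The coordinate `w = y - x p`. -/
def wCoord (P : Jet) : ℝ := P.2.1 - P.1 * P.2.2

theorem jet_ext_coord {P R : Jet} (hR : R ∈ phase) (hp : P.2.2 = R.2.2)
    (hz : zCoord P = zCoord R) (hw : wCoord P = wCoord R) : P = R := by
  have hR' : R.2.2 ≠ 0 := hR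
  unfold zCoord wCoord at *
  rw [hp] at hz hw
  have hx : P.1 = R.1 := mul_right_cancel₀ hR' hz
  refine Prod.ext hx (Prod.ext ?_ hp)
  rw [hx] at hw
  linarith

theorem cast_units_sq (s : ℤˣ) : ((s : ℤ) : ℝ) * ((s : ℤ) : ℝ) = 1 := by
  rcases Int.units_eq_one_or s with rfl | rfl <;> simp

theorem cast_units_ne_zero (s : ℤˣ) : ((s : ℤ) : ℝ) ≠ 0 := fun h => by
  simpa [h] using cast_units_sq s

/-- The discrete symmetry with `p̂ = t p ^ ε`, `x̂ p̂ = s x p` and `ŷ - x̂ p̂ = s ε (y - x p)`, where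
`d = (s, t, ε)` consists of signs. -/
def discreteMap (d : ℤˣ × ℤˣ × ℤˣ) (P : Jet) : Jet :=
  ((d.1 : ℤ) * (P.1 * P.2.2) / ((d.2.1 : ℤ) * P.2.2 ^ (d.2.2 : ℤ)),
    (d.1 : ℤ) * ((d.2.2 : ℤ) * P.2.1 + (1 - (d.2.2 : ℤ)) * (P.1 * P.2.2)),
    (d.2.1 : ℤ) * P.2.2 ^ (d.2.2 : ℤ))

theorem discreteMap_mem (d : ℤˣ × ℤˣ × ℤˣ) {P : Jet} (hP : P ∈ phase) :
    discreteMap d P ∈ phase :=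
  mul_ne_zero (cast_units_ne_zero _) (zpow_ne_zero _ hP)

theorem zCoord_discreteMap (d : ℤˣ × ℤˣ × ℤˣ) {P : Jet} (hP : P ∈ phase) :
    zCoord (discreteMap d P) = (d.1 : ℤ) * zCoord P :=
  div_mul_cancel₀ _ (discreteMap_mem d hP)

theorem wCoord_discreteMap (d : ℤˣ × ℤˣ × ℤˣ) {P : Jet} (hP : P ∈ phase) :
    wCoord (discreteMap d P) = (d.1 : ℤ) * (d.2.2 : ℤ) * wCoord P := by
  have h := zCoord_discreteMap d hP
  unfold zCoord at h
  rw [wCoord, h, wCoord]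
  simp only [discreteMap]
  ring

theorem discreteMap_mul (d e : ℤˣ × ℤˣ × ℤˣ) {P : Jet} (hP : P ∈ phase) :
    discreteMap (d * e) P = discreteMap d (discreteMap e P) := by
  have he := discreteMap_mem e hP
  refine jet_ext_coord (discreteMap_mem d he) ?_ ?_ ?_
  · have h : (((e.2.1 : ℤ) : ℝ)) ^ (d.2.2 : ℤ) = (e.2.1 : ℤ) := by
      rcases Int.units_eq_one_or e.2.1 with h | h <;>
        rcases Int.units_eq_one_or d.2.2 with h' | h' <;> simp [h, h']
    simp only [discreteMap, Prod.snd_mul, Prod.fst_mul, mul_zpow, h, Units.val_mul, Int.cast_mul,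
      ← zpow_mul]
    rw [mul_comm (d.2.2 : ℤ), mul_assoc]
  · rw [zCoord_discreteMap _ hP, zCoord_discreteMap _ he, zCoord_discreteMap _ hP]
    simp [mul_assoc]
  · rw [wCoord_discreteMap _ hP, wCoord_discreteMap _ he, wCoord_discreteMap _ hP]
    simp
    ring

theorem discreteMap_one {P : Jet} (hP : P ∈ phase) : discreteMap 1 P = P := by
  have hp : P.2.2 ≠ 0 := hP
  simp [discreteMap, hp]

/-- The discrete symmetries as a homomorphism to the permutations of the phase space. -/
def discretePerm : ℤˣ × ℤˣ × ℤˣ →* Equiv.Perm phase :=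
  MonoidHom.toHomPerm
    { toFun := fun d P => (⟨discreteMap d P.1, discreteMap_mem d P.2⟩ : phase)
      map_one' := funext fun P => Subtype.ext (discreteMap_one P.2)
      map_mul' := fun d e => funext fun P => Subtype.ext (discreteMap_mul d e P.2) }

theorem discretePerm_apply (d : ℤˣ × ℤˣ × ℤˣ) (P : phase) :
    (discretePerm d P : Jet) = discreteMap d P := rfl

theorem toMap_discretePerm (d : ℤˣ × ℤˣ × ℤˣ) {P : Jet} (hP : P ∈ phase) :
    toMap (discretePerm d) P = discreteMap d P := by
  rw [toMap, dif_pos hP]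
  rfl

theorem discretePerm_injective : Function.Injective discretePerm := by
  refine (injective_iff_map_eq_one _).2 fun d h => ?_
  have key : ∀ P : Jet, P ∈ phase → discreteMap d P = P := fun P hP => by
    rw [← toMap_discretePerm d hP, h, toMap, dif_pos hP]
    rfl
  -- The image of this one point is `(s / t, s (1 - ε), t)`, which already determines all three
  -- signs.
  have h1 := key (1, 0, 1) one_ne_zero
  obtain ⟨s, t, u⟩ := d
  rcases Int.units_eq_one_or s with rfl | rfl <;> rcases Int.units_eq_one_or t with rfl | rfl <;>
    rcases Int.units_eq_one_or u with rfl | rfl <;>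
    first | rfl | norm_num [discreteMap] at h1

theorem discretePerm_Γ₁ : discretePerm (1, -1, 1) = Γ₁ := by
  ext P : 2
  have hp : P.1.2.2 ≠ 0 := P.2
  rw [discretePerm_apply]
  simp [discreteMap, Γ₁, hp, div_neg]

theorem discretePerm_Γ₂ : discretePerm (-1, -1, 1) = Γ₂ := by
  ext P : 2
  have hp : P.1.2.2 ≠ 0 := P.2
  rw [discretePerm_apply]
  simp [discreteMap, Γ₂, hp]

theorem discretePerm_Γ₃ : discretePerm (1, 1, -1) = Γ₃ := by
  ext P : 2
  have hp : P.1.2.2 ≠ 0 := P.2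
  rw [discretePerm_apply]
  simp [discreteMap, Γ₃, legendreMap]
  refine ⟨?_, ?_⟩ <;> ring

theorem discreteGroup_eq_range : discreteGroup = discretePerm.range := by
  apply le_antisymm
  · rw [discreteGroup, Subgroup.closure_le]
    rintro d (rfl | rfl | rfl)
    · exact ⟨_, discretePerm_Γ₁⟩
    · exact ⟨_, discretePerm_Γ₂⟩
    · exact ⟨_, discretePerm_Γ₃⟩
  · have h1 : discretePerm (1, -1, 1) ∈ discreteGroup :=
      Subgroup.subset_closure (by simp [discretePerm_Γ₁])
    have h2 : discretePerm (-1, -1, 1) ∈ discreteGroup :=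
      Subgroup.subset_closure (by simp [discretePerm_Γ₂])
    have h3 : discretePerm (1, 1, -1) ∈ discreteGroup :=
      Subgroup.subset_closure (by simp [discretePerm_Γ₃])
    have h4 : discretePerm (-1, 1, 1) ∈ discreteGroup := by
      have : ((-1, 1, 1) : ℤˣ × ℤˣ × ℤˣ) = (1, -1, 1) * (-1, -1, 1) := by decide
      rw [this, map_mul]
      exact mul_mem h1 h2
    rintro _ ⟨⟨s, t, u⟩, rfl⟩
    have : ((s, t, u) : ℤˣ × ℤˣ × ℤˣ) = (s, 1, 1) * (1, t, 1) * (1, 1, u) := by simp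
    rw [this, map_mul, map_mul]
    have h5 : discretePerm (1, 1, 1) ∈ discreteGroup := by
      rw [show ((1, 1, 1) : ℤˣ × ℤˣ × ℤˣ) = 1 from rfl, map_one]
      exact one_mem _
    refine mul_mem (mul_mem ?_ ?_) ?_
    · rcases Int.units_eq_one_or s with rfl | rfl
      exacts [h5, h4]
    · rcases Int.units_eq_one_or t with rfl | rfl
      exacts [h5, h1]
    · rcases Int.units_eq_one_or u with rfl | rfl
      exacts [h5, h3]

theorem nonempty_discreteGroup_mulEquiv :
    Nonempty (discreteGroup ≃* Multiplicative (ZMod 2 × ZMod 2 × ZMod 2)) := by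
  have : Fact (Nat.Prime 2) := ⟨Nat.prime_two⟩
  have e : ℤˣ ≃* Multiplicative (ZMod 2) :=
    mulEquivOfPrimeCardEq (p := 2) (by simp) (by simp)
  have f : ℤˣ × ℤˣ × ℤˣ ≃* discreteGroup :=
    (MonoidHom.ofInjective discretePerm_injective).trans
      (MulEquiv.subgroupCongr discreteGroup_eq_range.symm)
  exact ⟨f.symm.trans ((e.prodCongr
    ((e.prodCongr e).trans (MulEquiv.prodMultiplicative _ _).symm)).trans
      (MulEquiv.prodMultiplicative _ _).symm)⟩

/-! ### The discrete maps are symmetries -/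

theorem hasFDerivAt_unit_zpow (t ε : ℤˣ) {P : Jet} (hP : P ∈ phase) :
    HasFDerivAt (fun R : Jet => ((t : ℤ) : ℝ) * R.2.2 ^ (ε : ℤ))
      ((((ε : ℤ) : ℝ) * ((t : ℤ) * P.2.2 ^ (ε : ℤ)) / P.2.2) •
        (ContinuousLinearMap.snd ℝ ℝ ℝ).comp (ContinuousLinearMap.snd ℝ ℝ (ℝ × ℝ))) P := by
  have hp : P.2.2 ≠ 0 := hP
  have h2 : HasFDerivAt (fun P : Jet => P.2) (ContinuousLinearMap.snd ℝ ℝ (ℝ × ℝ)) P :=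
    hasFDerivAt_snd
  refine (((hasDerivAt_zpow (ε : ℤ) P.2.2 (Or.inl hp)).const_mul ((t : ℤ) : ℝ)).comp_hasFDerivAt P
    h2.snd).congr_fderiv ?_
  congr 1
  rw [zpow_sub_one₀ hp]
  field_simp

theorem fderiv_discreteMap_fst (d : ℤˣ × ℤˣ × ℤˣ) {P : Jet} (hP : P ∈ phase) (v : Jet) :
    fderiv ℝ (fun R => (discreteMap d R).1) P v
      = (d.1 : ℤ) * (P.2.2 * v.1 + (1 - (d.2.2 : ℤ)) * P.1 * v.2.2) / (discreteMap d P).2.2 := by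
  have hp : P.2.2 ≠ 0 := hP
  have hx : HasFDerivAt (fun P : Jet => P.1) (ContinuousLinearMap.fst ℝ ℝ (ℝ × ℝ)) P :=
    hasFDerivAt_fst
  have h2 : HasFDerivAt (fun P : Jet => P.2) (ContinuousLinearMap.snd ℝ ℝ (ℝ × ℝ)) P :=
    hasFDerivAt_snd
  have hq : (discreteMap d P).2.2 ≠ 0 := discreteMap_mem d hP
  have h := ((hx.mul h2.snd).const_mul ((d.1 : ℤ) : ℝ)).real_div
    (hasFDerivAt_unit_zpow d.2.1 d.2.2 hP) hq
  rw [HasFDerivAt.fderiv (f := fun R => (discreteMap d R).1) h]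
  change (_ : ℝ) = _ / (((d.2.1 : ℤ) : ℝ) * P.2.2 ^ (d.2.2 : ℤ))
  change ((d.2.1 : ℤ) : ℝ) * P.2.2 ^ (d.2.2 : ℤ) ≠ 0 at hq
  generalize ((d.2.1 : ℤ) : ℝ) * P.2.2 ^ (d.2.2 : ℤ) = q at *
  simp
  field_simp
  ring

theorem fderiv_discreteMap_snd_fst (d : ℤˣ × ℤˣ × ℤˣ) (P : Jet) (v : Jet) :
    fderiv ℝ (fun R => (discreteMap d R).2.1) P v
      = (d.1 : ℤ) * ((d.2.2 : ℤ) * v.2.1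
        + (1 - (d.2.2 : ℤ)) * (P.2.2 * v.1 + P.1 * v.2.2)) := by
  have hx : HasFDerivAt (fun P : Jet => P.1) (ContinuousLinearMap.fst ℝ ℝ (ℝ × ℝ)) P :=
    hasFDerivAt_fst
  have h2 : HasFDerivAt (fun P : Jet => P.2) (ContinuousLinearMap.snd ℝ ℝ (ℝ × ℝ)) P :=
    hasFDerivAt_snd
  have h := ((h2.fst.const_mul ((d.2.2 : ℤ) : ℝ)).add
    ((hx.mul h2.snd).const_mul (1 - ((d.2.2 : ℤ) : ℝ)))).const_mul ((d.1 : ℤ) : ℝ)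
  rw [HasFDerivAt.fderiv (f := fun R => (discreteMap d R).2.1) h]
  simp
  ring

theorem fderiv_discreteMap_snd_snd (d : ℤˣ × ℤˣ × ℤˣ) {P : Jet} (hP : P ∈ phase) (v : Jet) :
    fderiv ℝ (fun R => (discreteMap d R).2.2) P v
      = (d.2.2 : ℤ) * (discreteMap d P).2.2 / P.2.2 * v.2.2 := by
  rw [HasFDerivAt.fderiv (f := fun R => (discreteMap d R).2.2)
    (hasFDerivAt_unit_zpow d.2.1 d.2.2 hP)]
  rfl

theorem contDiffOn_discreteMap (d : ℤˣ × ℤˣ × ℤˣ) : ContDiffOn ℝ ∞ (discreteMap d) phase := by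
  have hq : ContDiffOn ℝ ∞ (fun R : Jet => ((d.2.1 : ℤ) : ℝ) * R.2.2 ^ (d.2.2 : ℤ)) phase := by
    rcases Int.units_eq_one_or d.2.2 with h | h
    · simp only [h, Units.val_one, zpow_one]
      fun_prop
    · simp only [h, Units.val_neg, Units.val_one, zpow_neg_one]
      have hp : ContDiffOn ℝ ∞ (fun R : Jet => R.2.2) phase := by fun_prop
      exact contDiffOn_const.mul (hp.inv fun P hP => hP)
  refine ContDiffOn.prodMk (ContDiffOn.div (by fun_prop) hq fun P hP => discreteMap_mem d hP)
    (ContDiffOn.prodMk (by fun_prop) hq)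

theorem discreteMap_discreteMap (d : ℤˣ × ℤˣ × ℤˣ) {P : Jet} (hP : P ∈ phase) :
    discreteMap d (discreteMap d P) = P := by
  have h : d * d = 1 := by
    obtain ⟨s, t, u⟩ := d
    simp [Int.units_mul_self]
  rw [← discreteMap_mul d d hP, h, discreteMap_one hP]

/-- Each discrete map is an involution, so by the chain rule its derivatives at `P` and at the image
of `P` are mutually inverse. -/
theorem isInvertible_fderiv_discreteMap (d : ℤˣ × ℤˣ × ℤˣ) {P : Jet} (hP : P ∈ phase) :
    (fderiv ℝ (discreteMap d) P).IsInvertible := by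
  have hd : ∀ R ∈ phase, DifferentiableAt ℝ (discreteMap d) R := fun R hR =>
    ((contDiffOn_discreteMap d).contDiffAt (isOpen_phase.mem_nhds hR)).differentiableAt (by simp)
  have key : ∀ R ∈ phase, (fderiv ℝ (discreteMap d) (discreteMap d R)).comp
      (fderiv ℝ (discreteMap d) R) = ContinuousLinearMap.id ℝ Jet := fun R hR => by
    rw [← fderiv_comp R (hd _ (discreteMap_mem d hR)) (hd R hR)]
    have : discreteMap d ∘ discreteMap d =ᶠ[nhds R] id := by
      filter_upwards [isOpen_phase.mem_nhds hR] with S hS using discreteMap_discreteMap d hS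
    rw [this.fderiv_eq, fderiv_id]
  have h1 := key P hP
  have h2 := key _ (discreteMap_mem d hP)
  rw [discreteMap_discreteMap d hP] at h2
  exact ContinuousLinearMap.IsInvertible.of_inverse h2 h1

theorem contactAt_discreteMap (d : ℤˣ × ℤˣ × ℤˣ) {P : Jet} (hP : P ∈ phase) :
    ContactAt (discreteMap d) P := by
  have hq : (discreteMap d P).2.2 ≠ 0 := discreteMap_mem d hP
  unfold ContactAt dx dy dp
  simp only [fderiv_discreteMap_fst d hP, fderiv_discreteMap_snd_fst]
  constructor <;> field_simp <;> ring

theorem symmetryAt_discreteMap {m : ℝ} (d : ℤˣ × ℤˣ × ℤˣ) {P : Jet}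
    (hP : P ∈ phase) : (familyODE m).SymmetryAt (discreteMap d) P := by
  intro h1 h2
  have hp : P.2.2 ≠ 0 := hP
  have hq : (discreteMap d P).2.2 ≠ 0 := discreteMap_mem d hP
  have hz : (discreteMap d P).1 * (discreteMap d P).2.2 = (d.1 : ℤ) * (P.1 * P.2.2) :=
    zCoord_discreteMap d hP
  change P.2.1 - (m + 1) * P.1 * P.2.2 ≠ 0 at h1
  change (discreteMap d P).2.1 - (m + 1) * (discreteMap d P).1 * (discreteMap d P).2.2 ≠ 0 at h2
  have hr : (familyODE m).rhs (discreteMap d P) = m * (discreteMap d P).2.2 ^ 2 /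
    ((discreteMap d P).2.1 - (m + 1) * (discreteMap d P).1 * (discreteMap d P).2.2) := rfl
  have hr' : (familyODE m).rhs P = m * P.2.2 ^ 2 / (P.2.1 - (m + 1) * P.1 * P.2.2) := rfl
  have hy : (discreteMap d P).2.1 = (d.1 : ℤ) * ((d.2.2 : ℤ) * P.2.1
    + (1 - (d.2.2 : ℤ)) * (P.1 * P.2.2)) := rfl
  have hs := cast_units_sq d.1
  have hs0 := cast_units_ne_zero d.1
  rw [mul_assoc, hz, hy] at h2 hr
  unfold ODE2.totalD
  rw [fderiv_discreteMap_fst d hP, fderiv_discreteMap_snd_snd d hP, hr, hr']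
  generalize (discreteMap d P).2.2 = q at *
  generalize ((d.1 : ℤ) : ℝ) = s at *
  obtain ⟨x, y, p⟩ := P
  simp only at *
  rcases Int.units_eq_one_or d.2.2 with h | h
  · simp only [h, Units.val_one, Int.cast_one, sub_self, zero_mul, add_zero, one_mul] at h2 ⊢
    have h3 : s * y - (m + 1) * (s * (x * p)) = s * (y - (m + 1) * x * p) := by ring
    rw [h3]
    refine ⟨by positivity, ?_⟩
    field_simp
  -- For `ε = -1` the image has `W` equal to `-s (W + 2 m x p)`, and `D x̂` contains the same
  -- factor. Thus `D x̂ ≠ 0` follows from the image lying in the domain.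
  · simp only [h, Units.val_neg, Units.val_one, Int.cast_neg, Int.cast_one] at h2 ⊢
    have h3 : s * (-1 * y + (1 - -1) * (x * p)) - (m + 1) * (s * (x * p))
        = -s * (y - (m + 1) * x * p + 2 * m * (x * p)) := by ring
    rw [h3] at h2 ⊢
    generalize y - (m + 1) * x * p = B at *
    have h4 : B + 2 * m * (x * p) ≠ 0 := fun h => h2 (by rw [h, mul_zero])
    have h5 : s * (p * 1 + (1 - -1) * x * (m * p ^ 2 / (B))) / q
        = s * p * (B + 2 * m * (x * p)) / (q * (B)) := by
      field_simp
      ring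
    rw [h5]
    refine ⟨by positivity, ?_⟩
    generalize B + 2 * m * (x * p) = A at *
    field_simp

theorem isUniformContactSymmetryOn_congr {O : ODE2} {V : Set Jet} (hV : IsOpen V)
    {Γ Γ' : Jet → Jet} (h : Set.EqOn Γ Γ' V) (hΓ : O.IsUniformContactSymmetryOn V Γ) :
    O.IsUniformContactSymmetryOn V Γ' := by
  have hE : ∀ P ∈ V, Γ' =ᶠ[nhds P] Γ := fun P hP => by
    filter_upwards [hV.mem_nhds hP] with R hR using (h hR).symm
  have h1 : ∀ P ∈ V, (fun R => (Γ' R).1) =ᶠ[nhds P] fun R => (Γ R).1 := fun P hP =>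
    (hE P hP).fun_comp Prod.fst
  have h2 : ∀ P ∈ V, (fun R => (Γ' R).2.1) =ᶠ[nhds P] fun R => (Γ R).2.1 := fun P hP =>
    (hE P hP).fun_comp fun v => v.2.1
  have h3 : ∀ P ∈ V, (fun R => (Γ' R).2.2) =ᶠ[nhds P] fun R => (Γ R).2.2 := fun P hP =>
    (hE P hP).fun_comp fun v => v.2.2
  refine ⟨hΓ.contDiffOn.congr h.symm, hΓ.injOn.congr h, fun P hP => ?_, ?_, fun P hP => ?_,
    fun P hP => ?_⟩
  · rw [(hE P hP).fderiv_eq]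
    exact hΓ.isInvertible P hP
  · obtain ⟨k, Φ, Θ, Ψ, hk, H⟩ := hΓ.uniform
    exact ⟨k, Φ, Θ, Ψ, hk, fun P hP => by rw [← h hP, H P hP]⟩
  · have := hΓ.contact P hP
    unfold ContactAt dx dy dp at this ⊢
    rwa [(h1 P hP).fderiv_eq, (h2 P hP).fderiv_eq, ← h hP]
  · have := hΓ.symmetry P hP
    unfold ODE2.SymmetryAt ODE2.totalD at this ⊢
    rwa [(h1 P hP).fderiv_eq, (h3 P hP).fderiv_eq, ← h hP]

theorem isUniformContactSymmetryOn_toMap (m : ℝ) {d : Equiv.Perm phase}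
    (hd : d ∈ discreteGroup) : (familyODE m).IsUniformContactSymmetryOn phase (toMap d) := by
  rw [discreteGroup_eq_range] at hd
  obtain ⟨d, rfl⟩ := hd
  refine isUniformContactSymmetryOn_congr isOpen_phase (Γ := discreteMap d)
    (fun P hP => (toMap_discretePerm d hP).symm) ⟨contDiffOn_discreteMap d, fun P hP R hR h => ?_,
      fun P hP => isInvertible_fderiv_discreteMap d hP, ?_, fun P hP => contactAt_discreteMap d hP,
      fun P hP => symmetryAt_discreteMap d hP⟩
  · rw [← discreteMap_discreteMap d hP, h, discreteMap_discreteMap d hR]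
  · refine ⟨(d.1 : ℤ) * (d.2.2 : ℤ), fun x p => (discreteMap d (x, 0, p)).1,
      fun x p => (discreteMap d (x, 0, p)).2.1, fun x p => (discreteMap d (x, 0, p)).2.2,
      mul_ne_zero (cast_units_ne_zero _) (cast_units_ne_zero _), fun P _ => ?_⟩
    simp only [discreteMap]
    refine Prod.ext rfl (Prod.ext ?_ rfl)
    simp only
    ring

/-! ### Normal form of uniform contact symmetries -/

/-- On `V`, the map `Γ` is given by `p̂ = l p ^ ε`, `ẑ = k z - H₁(p̂)` and
`ŵ = k ε w + H(p̂)`, where `z = x p`, `w = y - x p` and `H` solves the Euler equation. -/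
structure NormalFormOn (κ : ℝ) (V : Set Jet) (Γ : Jet → Jet) (k l : ℝ) (ε : ℤˣ)
    (H H₁ : ℝ → ℝ) : Prop where
  k_ne_zero : k ≠ 0
  l_ne_zero : l ≠ 0
  euler : IsEuler κ H H₁
  p_eq : ∀ P ∈ V, (Γ P).2.2 = l * P.2.2 ^ (ε : ℤ)
  z_eq : ∀ P ∈ V, zCoord (Γ P) = k * zCoord P - H₁ (Γ P).2.2
  w_eq : ∀ P ∈ V, wCoord (Γ P) = k * (ε : ℤ) * wCoord P + H (Γ P).2.2

/-- The symmetry condition of the family, split by powers of `y - (m + 1) x p`. -/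
theorem finite_determining_equations {m : ℝ} (hm : m ≠ 0) {V : Set Jet} (hV : IsOpen V)
    (hVp : V ⊆ phase) {F G R : Jet → ℝ} {k : ℝ} (hk : k ≠ 0)
    (hF : ∀ P ∈ V, DifferentiableAt ℝ F P) (hR : ∀ P ∈ V, DifferentiableAt ℝ R P)
    (aF : AffineInY V F 0) (aG : AffineInY V G k) (aR : AffineInY V R 0)
    (hs : ∀ P ∈ V, (familyODE m).SymmetryAt (fun P => (F P, G P, R P)) P) {P : Jet} (hP : P ∈ V) :
    dx R P = 0 ∧ P.2.2 ^ 2 * k * dp R P = R P ^ 2 * dx F P ∧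
      dp R P * (G P - k * (P.2.1 - (m + 1) * P.1 * P.2.2) - (m + 1) * F P * R P)
        = m * R P ^ 2 * dp F P := by
  have hp : P.2.2 ≠ 0 := hVp hP
  -- At the point of the vertical line where `W = u`, the image has `W` equal to `k u + T`. The
  -- excluded values `u = 0` and `k u + T = 0` are those where the source or the image leaves the
  -- domain.
  set T := G P - k * (P.2.1 - (m + 1) * P.1 * P.2.2) - (m + 1) * F P * R P with hT
  obtain ⟨h1, h2, h3⟩ : k * dx R P = 0 ∧
      dx R P * T + m * P.2.2 ^ 2 * k * dp R P - m * R P ^ 2 * dx F P = 0 ∧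
      m * P.2.2 ^ 2 * dp R P * T - m ^ 2 * R P ^ 2 * P.2.2 ^ 2 * dp F P = 0 := by
    refine quadratic_coeff_eq_zero (k := k) (T := T)
      (infinite_vertical hV hP (P.2.1 - (m + 1) * P.1 * P.2.2)) hk fun u hu hu0 hkT => ?_
    set t := u - (P.2.1 - (m + 1) * P.1 * P.2.2) with ht
    have hu' : P + (0, t, 0) ∈ V := hu
    have hW : (P + (0, t, 0)).2.1 - (m + 1) * (P + (0, t, 0)).1 * (P + (0, t, 0)).2.2 = u := by
      simp [ht]
      ring
    have hdom : P + (0, t, 0) ∈ (familyODE m).dom := by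
      change (P + (0, t, 0)).2.1 - (m + 1) * (P + (0, t, 0)).1 * (P + (0, t, 0)).2.2 ≠ 0
      rwa [hW]
    have e1 := aF P hP t hu'
    have e2 := aG P hP t hu'
    have e3 := aR P hP t hu'
    have hWh : G (P + (0, t, 0)) - (m + 1) * F (P + (0, t, 0)) * R (P + (0, t, 0))
        = k * u + T := by
      rw [e1, e2, e3, hT, ht]
      ring
    have hdom' : (F (P + (0, t, 0)), G (P + (0, t, 0)), R (P + (0, t, 0)))
        ∈ (familyODE m).dom := by
      change G (P + (0, t, 0)) - (m + 1) * F (P + (0, t, 0)) * R (P + (0, t, 0)) ≠ 0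
      rwa [hWh]
    obtain ⟨hne, heq⟩ := hs _ hu' hdom hdom'
    have hr : (familyODE m).rhs (P + (0, t, 0)) = m * P.2.2 ^ 2 / u := by
      change m * (P + (0, t, 0)).2.2 ^ 2 / _ = _
      rw [hW]; simp
    have hr' : (familyODE m).rhs (F (P + (0, t, 0)), G (P + (0, t, 0)), R (P + (0, t, 0)))
        = m * R (P + (0, t, 0)) ^ 2 / (k * u + T) := by
      change m * R (P + (0, t, 0)) ^ 2 / _ = _
      rw [hWh]
    have d1 := aF.fderiv_apply hV (1, 0, 0) P hP t hu'
    have d2 := aF.fderiv_apply hV (0, 0, 1) P hP t hu'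
    have d3 := aR.fderiv_apply hV (1, 0, 0) P hP t hu'
    have d4 := aR.fderiv_apply hV (0, 0, 1) P hP t hu'
    change dx F _ = dx F P + _ at d1
    change dp F _ = dp F P + _ at d2
    change dx R _ = dx R P + _ at d3
    change dp R _ = dp R P + _ at d4
    unfold ODE2.totalD at hne heq
    simp only [fderiv_jet_apply, hr, d1, d2, d3, d4, aF.dy_eq hV hu' (hF _ hu'),
      aR.dy_eq hV hu' (hR _ hu'), mul_zero, add_zero, one_mul] at hne heq
    rw [div_eq_iff hne, hr', e3, mul_zero, add_zero] at heq
    have hkT' : u * k + T ≠ 0 := by rwa [mul_comm]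
    clear_value T
    field_simp at heq
    linear_combination heq
  have h1' : dx R P = 0 := (mul_eq_zero.1 h1).resolve_left hk
  refine ⟨h1', ?_, ?_⟩
  · rw [h1'] at h2
    have : m * (P.2.2 ^ 2 * k * dp R P - R P ^ 2 * dx F P) = 0 := by linear_combination h2
    linarith [(mul_eq_zero.1 this).resolve_left hm]
  · have : m * P.2.2 ^ 2 * (dp R P * T - m * R P ^ 2 * dp F P) = 0 := by linear_combination h3
    linarith [(mul_eq_zero.1 this).resolve_left (by positivity)]

theorem exists_normalFormOn {m : ℝ} (hm : m ≠ 0) {V : Set Jet} (hV : IsOpen V)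
    (hVc : IsConnected V) (hVp : V ⊆ phase) {Γ : Jet → Jet}
    (hΓ : (familyODE m).IsUniformContactSymmetryOn V Γ) :
    ∃ k l ε H H₁, NormalFormOn (-1 / m) V Γ k l ε H H₁ := by
  obtain ⟨C, S, hCS⟩ := exists_isEulerSystem (κ := -1 / m) (div_ne_zero (by norm_num) hm)
  obtain ⟨k, Φ, Θ, Ψ, hk, hform⟩ := hΓ.uniform
  set F : Jet → ℝ := fun P => (Γ P).1 with hFdef
  set G : Jet → ℝ := fun P => (Γ P).2.1 with hGdef
  set R : Jet → ℝ := fun P => (Γ P).2.2 with hRdef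
  have sF : ContDiffOn ℝ ∞ F V := contDiff_fst.comp_contDiffOn hΓ.contDiffOn
  have sG : ContDiffOn ℝ ∞ G V :=
    (contDiff_fst.comp contDiff_snd).comp_contDiffOn hΓ.contDiffOn
  have sR : ContDiffOn ℝ ∞ R V :=
    (contDiff_snd.comp contDiff_snd).comp_contDiffOn hΓ.contDiffOn
  have diff : ∀ {f : Jet → ℝ}, ContDiffOn ℝ ∞ f V → ∀ P ∈ V, DifferentiableAt ℝ f P :=
    fun hf P hP => (hf.contDiffAt (hV.mem_nhds hP)).differentiableAt (by simp)
  have aF : AffineInY V F 0 := fun P hP t ht => by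
    simp only [hFdef, hform P hP, hform _ ht]; simp
  have aG : AffineInY V G k := fun P hP t ht => by
    simp only [hGdef, hform P hP, hform _ ht]; simp; ring
  have aR : AffineInY V R 0 := fun P hP t ht => by
    simp only [hRdef, hform P hP, hform _ ht]; simp
  have dyF := fun P (hP : P ∈ V) => aF.dy_eq hV hP (diff sF P hP)
  have dyG := fun P (hP : P ∈ V) => aG.dy_eq hV hP (diff sG P hP)
  have dyR := fun P (hP : P ∈ V) => aR.dy_eq hV hP (diff sR P hP)
  have hdet := fun P (hP : P ∈ V) => finite_determining_equations hm hV hVp hk (diff sF) (diff sR)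
    aF aG aR hΓ.symmetry hP
  have hx : ∀ P : Jet, HasFDerivAt (fun P : Jet => P.1) (ContinuousLinearMap.fst ℝ ℝ (ℝ × ℝ)) P :=
    fun P => hasFDerivAt_fst
  have h2 : ∀ P : Jet, HasFDerivAt (fun P : Jet => P.2) (ContinuousLinearMap.snd ℝ ℝ (ℝ × ℝ)) P :=
    fun P => hasFDerivAt_snd
  -- `p̂_x = p̂_y = 0`, so a zero of `p̂_p` would make `dp̂` vanish, against surjectivity of the
  -- derivative of `Γ`.
  have hdpR : ∀ P ∈ V, dp R P ≠ 0 := fun P hP h0 => by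
    obtain ⟨v, hv⟩ := (hΓ.isInvertible P hP).bijective.surjective (0, 0, 1)
    have hd : DifferentiableAt ℝ Γ P :=
      (hΓ.contDiffOn.contDiffAt (hV.mem_nhds hP)).differentiableAt (by simp)
    have h : fderiv ℝ R P v = (fderiv ℝ Γ P v).2.2 := by
      rw [HasFDerivAt.fderiv (f := R) hd.hasFDerivAt.snd.snd]
      rfl
    obtain ⟨a, b, c⟩ := v
    rw [hv, fderiv_jet_apply, (hdet P hP).1, dyR P hP, h0] at h
    simp at h
  have hR0 : ∀ P ∈ V, R P ≠ 0 := fun P hP h0 => by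
    have h := (hdet P hP).2.1
    have hp : P.2.2 ≠ 0 := hVp hP
    rw [h0] at h
    have : P.2.2 ^ 2 * k * dp R P ≠ 0 := mul_ne_zero (by positivity) (hdpR P hP)
    exact this (by rw [h]; ring)
  have c1 : ∀ P ∈ V, dx G P + P.2.2 * k = dx F P * R P := fun P hP => by
    have h := (hΓ.contact P hP).1
    change dx G P + P.2.2 * dy G P = (dx F P + P.2.2 * dy F P) * R P at h
    rw [dyG P hP, dyF P hP] at h
    linarith
  have c2 : ∀ P ∈ V, dp G P = dp F P * R P := fun P hP => (hΓ.contact P hP).2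
  -- Cross-differentiating `ŷ_x = x̂_x p̂ - k p` and `ŷ_p = x̂_p p̂` gives `x̂_x p̂_p - x̂_p p̂_x =
  -- k`, and `p̂_x = 0`.
  have hxR : ∀ P ∈ V, dx F P * dp R P = k := fun P hP => by
    have e1 : dx G =ᶠ[nhds P] fun P => dx F P * R P - P.2.2 * k := by
      filter_upwards [hV.mem_nhds hP] with Q hQ using eq_sub_of_add_eq (c1 Q hQ)
    have e2 : dp G =ᶠ[nhds P] fun P => dp F P * R P := by
      filter_upwards [hV.mem_nhds hP] with Q hQ using c2 Q hQ
    have d1 := (diff (contDiffOn_fderiv_apply hV sF (1, 0, 0)) P hP).hasFDerivAt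
    have d2 := (diff (contDiffOn_fderiv_apply hV sF (0, 0, 1)) P hP).hasFDerivAt
    have d3 := (diff sR P hP).hasFDerivAt
    have g1 := e1.fderiv_eq.trans ((d1.mul d3).sub ((h2 P).snd.mul_const k)).fderiv
    have g2 := e2.fderiv_eq.trans (d2.mul d3).fderiv
    have g1' := congrArg (fun L : Jet →L[ℝ] ℝ => L (0, 0, 1)) g1
    have g2' := congrArg (fun L : Jet →L[ℝ] ℝ => L (1, 0, 0)) g2
    simp at g1' g2'
    have sG' := fderiv_fderiv_apply_comm (sG.contDiffAt (hV.mem_nhds hP)) (1, 0, 0) (0, 0, 1)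
    have sF' := fderiv_fderiv_apply_comm (sF.contDiffAt (hV.mem_nhds hP)) (1, 0, 0) (0, 0, 1)
    change fderiv ℝ (dx G) P (0, 0, 1) = fderiv ℝ (dp G) P (1, 0, 0) at sG'
    rw [g1', g2', sF'] at sG'
    have := (hdet P hP).1
    change fderiv ℝ R P (1, 0, 0) = 0 at this
    rw [this] at sG'
    change (fderiv ℝ F P (1, 0, 0)) * (fderiv ℝ R P (0, 0, 1)) = k
    linarith
  -- Multiplying `p² k p̂_p = p̂² x̂_x` by `p̂_p` and using `x̂_x p̂_p = k` gives `(p p̂_p)² = p̂²`.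
  -- Since `p̂` has no zero and `V` is connected, one sign holds throughout.
  obtain ⟨ε, hε⟩ : ∃ ε : ℤˣ, ∀ P ∈ V, P.2.2 * dp R P = (ε : ℤ) * R P := by
    have hsq : Set.EqOn ((fun P : Jet => P.2.2 * dp R P) ^ 2) (R ^ 2) V := fun P hP => by
      have h := (hdet P hP).2.1
      have h' := hxR P hP
      simp only [Pi.pow_apply]
      have : k * ((P.2.2 * dp R P) ^ 2 - R P ^ 2) = 0 := by
        linear_combination dp R P * h + R P ^ 2 * h'
      linarith [(mul_eq_zero.1 this).resolve_left hk]
    have hc : ContinuousOn (fun P : Jet => P.2.2 * dp R P) V :=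
      ContinuousOn.mul (by fun_prop) (contDiffOn_fderiv_apply hV sR (0, 0, 1)).continuousOn
    rcases hVc.isPreconnected.eq_or_eq_neg_of_sq_eq hc sR.continuousOn hsq
      (fun {P} hP => hR0 P hP) with h | h
    · exact ⟨1, fun P hP => by simpa using h hP⟩
    · exact ⟨-1, fun P hP => by simpa using h hP⟩
  have hεε := cast_units_sq ε
  obtain ⟨l, hl⟩ : ∃ l, ∀ P ∈ V, R P = l * P.2.2 ^ (ε : ℤ) := by
    have hd : ∀ P ∈ V, HasFDerivAt
        (fun P => R P * ((((1 : ℤˣ) : ℤ) : ℝ) * P.2.2 ^ ((-ε : ℤˣ) : ℤ)))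
        (0 : Jet →L[ℝ] ℝ) P := fun P hP => by
      have hp : P.2.2 ≠ 0 := hVp hP
      refine ((diff sR P hP).hasFDerivAt.mul (hasFDerivAt_unit_zpow 1 (-ε) (hVp hP))).congr_fderiv ?_
      have e := hε P hP
      refine fderiv_jet_ext ?_ ?_ ?_ <;>
        simp [fderiv_jet_apply, (hdet P hP).1, dyR P hP]
      field_simp
      linear_combination e
    obtain ⟨l, h⟩ := hV.exists_is_const_of_fderiv_eq_zero hVc.isPreconnected
      (fun P hP => (hd P hP).differentiableAt.differentiableWithinAt) fun P hP => (hd P hP).fderiv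
    refine ⟨l, fun P hP => ?_⟩
    have hp : P.2.2 ≠ 0 := hVp hP
    rw [← h P hP]
    simp [hp, zpow_ne_zero]
  -- Here `h = ŵ - k w` and `h₁ = k ε z - ẑ`. The contact conditions give `dh`, the last determining
  -- equation gives `dh₁`, both as multiples of `dp̂`.
  obtain ⟨a, b, hab⟩ := hCS.exists_coeff hV hVc.isPreconnected (q := R)
    (h := fun P => G P - F P * R P - k * (P.2.1 - P.1 * P.2.2))
    (h₁ := fun P => k * (ε : ℤ) * (P.1 * P.2.2) - F P * R P) hR0 (diff sR)
    (fun P hP => by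
      have hp : P.2.2 ≠ 0 := hVp hP
      have hR := hR0 P hP
      refine (((diff sG P hP).hasFDerivAt.sub ((diff sF P hP).hasFDerivAt.mul
        (diff sR P hP).hasFDerivAt)).sub (((h2 P).fst.sub ((hx P).mul (h2 P).snd)).const_mul
          k)).congr_fderiv ?_
      have e1 := c1 P hP
      have e2 := c2 P hP
      have e3 : dp R P = (ε : ℤ) * R P / P.2.2 := by rw [← hε P hP]; field_simp
      refine fderiv_jet_ext ?_ ?_ ?_ <;>
        simp [fderiv_jet_apply, (hdet P hP).1, dyR P hP, dyF P hP, dyG P hP]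
      · linear_combination e1
      · rw [e2, e3]
        field_simp
        linear_combination (-k * P.1 * P.2.2) * hεε)
    (fun P hP => by
      have hp : P.2.2 ≠ 0 := hVp hP
      have hR := hR0 P hP
      refine ((((hx P).mul (h2 P).snd).const_mul (k * ((ε : ℤ) : ℝ))).sub
        ((diff sF P hP).hasFDerivAt.mul (diff sR P hP).hasFDerivAt)).congr_fderiv ?_
      have e1 := hxR P hP
      have e2 := (hdet P hP).2.2
      have e3 : dp R P = (ε : ℤ) * R P / P.2.2 := by rw [← hε P hP]; field_simp
      have hε0 := cast_units_ne_zero ε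
      rw [e3] at e1 e2
      refine fderiv_jet_ext ?_ ?_ ?_ <;>
        simp [fderiv_jet_apply, (hdet P hP).1, dyR P hP, dyF P hP]
      · field_simp at e1
        linear_combination (-((ε : ℤ) : ℝ)) * e1 + (dx F P * R P) * hεε
      · rw [e3]
        generalize ((ε : ℤ) : ℝ) = e at *
        have e4 : dp F P = e * (G P - k * (P.2.1 - (m + 1) * P.1 * P.2.2)
            - (m + 1) * F P * R P) / (P.2.2 * m * R P) := by
          field_simp at e2 ⊢
          linear_combination -e2
        rw [e4]
        field_simp
        ring)
  -- The normal form is normalised by the factor of `z`, which is `k ε` for `k` the slope of `ŷ` in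
  -- `y`.
  refine ⟨k * (ε : ℤ), l, ε, fun p => a * C p + b * S p,
    fun p => a * (-1 / m * S p) + b * C p, mul_ne_zero hk (cast_units_ne_zero ε), ?_, ?_, hl, ?_, ?_⟩
  · obtain ⟨P, hP⟩ := hVc.nonempty
    intro h0
    exact hR0 P hP (by rw [hl P hP, h0, zero_mul])
  · exact hCS.fst.linearCombination hCS.snd a b
  · intro P hP
    have h := (hab P hP).2
    change k * (ε : ℤ) * (P.1 * P.2.2) - F P * R P = _ at h
    change F P * R P = k * (ε : ℤ) * (P.1 * P.2.2) - (a * (-1 / m * S (R P)) + b * C (R P))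
    linarith
  · intro P hP
    have h := (hab P hP).1
    change G P - F P * R P - k * (P.2.1 - P.1 * P.2.2) = _ at h
    change G P - F P * R P = k * (ε : ℤ) * (ε : ℤ) * (P.2.1 - P.1 * P.2.2)
      + (a * C (R P) + b * S (R P))
    linear_combination h - k * (P.2.1 - P.1 * P.2.2) * hεε

/-! ### Flows of generators -/

/-- The component of the phase space on which `p` has the sign of `τ`. -/
def halfPhase (τ : ℝ) : Set Jet := {P | 0 < τ * P.2.2}

theorem isOpen_halfPhase (τ : ℝ) : IsOpen (halfPhase τ) :=
  isOpen_lt continuous_const (by fun_prop)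

theorem halfPhase_subset_phase (τ : ℝ) : halfPhase τ ⊆ phase := fun P hP h => by
  have h0 : 0 < τ * P.2.2 := hP
  rw [h, mul_zero] at h0
  exact lt_irrefl _ h0

theorem isConnected_halfPhase {τ : ℝ} (hτ : τ ≠ 0) : IsConnected (halfPhase τ) := by
  refine ⟨⟨(0, 0, τ), ?_⟩, Convex.isPreconnected ?_⟩
  · exact mul_self_pos.2 hτ
  · exact convex_halfSpace_gt (f := fun P : Jet => τ * P.2.2)
      ⟨fun P R => by simp [mul_add], fun c P => by simp; ring⟩ 0

/-- `phase` is disconnected, so the generator is taken on one half-space, which is convex and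
preserved by the flows used. -/
theorem flowStep_of_halfPhase {m : ℝ} (hm : m ≠ 0) {h h₁ : ℝ → ℝ} (hh : IsEuler (-1 / m) h h₁)
    (c α : ℝ) {τ : ℝ} (hτ : τ ≠ 0) {V : Set Jet} {Γ Γ' : Jet → Jet} (γ : ℝ → Jet → Jet)
    (h0 : ∀ P ∈ V, γ 0 P = Γ P) (h1 : ∀ P ∈ V, γ 1 P = Γ' P)
    (hN : ∀ P ∈ V, ∀ t, γ t P ∈ halfPhase τ)
    (hγ : ∀ P ∈ V, ∀ t, HasDerivAt (fun s => γ s P) (generatorField c α h h₁ (γ t P)) t) :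
    (familyODE m).FlowStep V Γ Γ' := by
  refine ⟨halfPhase τ, (halfPhase τ).indicator (generatorField c α h h₁), γ, isOpen_halfPhase τ,
    isConnected_halfPhase hτ, halfPhase_subset_phase τ,
    mem_uniformGenerators hm hh c α (isOpen_halfPhase τ) (halfPhase_subset_phase τ)
      (fun P hP => Set.indicator_of_notMem hP _) (fun P hP => Set.indicator_of_mem hP _),
    fun P hP => ⟨h0 P hP, h1 P hP, fun t _ => ⟨hN P hP t, ?_⟩⟩⟩
  rw [Set.indicator_of_mem (hN P hP t)]
  exact hγ P hP t

theorem flowStep_scaling {m : ℝ} (hm : m ≠ 0) (c α : ℝ) {τ : ℝ} (hτ : τ ≠ 0) {V : Set Jet}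
    {Γ Γ' : Jet → Jet} (hN : ∀ P ∈ V, Γ P ∈ halfPhase τ)
    (hΓ : ∀ P ∈ V, Γ' P = (Real.exp (-α) * (Γ P).1, Real.exp c * (Γ P).2.1,
      Real.exp (c + α) * (Γ P).2.2)) :
    (familyODE m).FlowStep V Γ Γ' := by
  refine flowStep_of_halfPhase hm IsEuler.zero c α hτ
    (fun t P => (Real.exp (-α * t) * (Γ P).1, Real.exp (c * t) * (Γ P).2.1,
      Real.exp ((c + α) * t) * (Γ P).2.2)) (fun P _ => by simp) (fun P hP => by simp [hΓ P hP])
    (fun P hP t => ?_) fun P hP t => ?_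
  · have h : 0 < τ * (Γ P).2.2 := hN P hP
    change 0 < τ * (Real.exp ((c + α) * t) * (Γ P).2.2)
    rw [mul_left_comm]
    exact mul_pos (Real.exp_pos _) h
  · have he : ∀ a b : ℝ, HasDerivAt (fun s : ℝ => Real.exp (a * s) * b)
        (a * (Real.exp (a * t) * b)) t := fun a b => by
      refine ((((hasDerivAt_id t).const_mul a).exp).mul_const b).congr_deriv ?_
      simp
      ring
    have h := (he (-α) (Γ P).1).prodMk ((he c (Γ P).2.1).prodMk (he (c + α) (Γ P).2.2))
    refine h.congr_deriv ?_
    simp [generatorField]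

/-- For `c = α = 0` the flow fixes `p`, so the velocity is constant along each orbit and the orbits
are straight lines. -/
theorem flowStep_translation {m : ℝ} (hm : m ≠ 0) {h h₁ : ℝ → ℝ} (hh : IsEuler (-1 / m) h h₁)
    {τ : ℝ} (hτ : τ ≠ 0) {V : Set Jet}
    {Γ Γ' : Jet → Jet} (hN : ∀ P ∈ V, Γ P ∈ halfPhase τ)
    (hΓ : ∀ P ∈ V, Γ' P = ((Γ P).1 - h₁ (Γ P).2.2 / (Γ P).2.2,
      (Γ P).2.1 + (h (Γ P).2.2 - h₁ (Γ P).2.2), (Γ P).2.2)) :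
    (familyODE m).FlowStep V Γ Γ' := by
  refine flowStep_of_halfPhase hm hh 0 0 hτ
    (fun t P => ((Γ P).1 + t * -(h₁ (Γ P).2.2 / (Γ P).2.2),
      (Γ P).2.1 + t * (h (Γ P).2.2 - h₁ (Γ P).2.2), (Γ P).2.2)) (fun P _ => by simp)
    (fun P hP => by simp [hΓ P hP, sub_eq_add_neg]) (fun P hP t => hN P hP) fun P hP t => ?_
  have he : ∀ a b : ℝ, HasDerivAt (fun s : ℝ => a + s * b) b t := fun a b => by
    simpa using ((hasDerivAt_id t).mul_const b).const_add a
  have h := (he (Γ P).1 (-(h₁ (Γ P).2.2 / (Γ P).2.2))).prodMk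
    ((he (Γ P).2.1 (h (Γ P).2.2 - h₁ (Γ P).2.2)).prodMk (hasDerivAt_const t (Γ P).2.2))
  refine h.congr_deriv ?_
  simp [generatorField]

theorem exists_unit_pos {a : ℝ} (ha : a ≠ 0) : ∃ s : ℤˣ, 0 < (s : ℤ) * a := by
  rcases lt_or_gt_of_ne ha with h | h
  · exact ⟨-1, by simpa using h⟩
  · exact ⟨1, by simpa using h⟩

theorem exists_sign {V : Set Jet} (hVc : IsConnected V) (hVp : V ⊆ phase) :
    ∃ s : ℤˣ, ∀ P ∈ V, 0 < ((s : ℤ) : ℝ) * P.2.2 := by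
  obtain ⟨P, hP⟩ := hVc.nonempty
  obtain ⟨s, hs⟩ := exists_unit_pos (a := P.2.2) (hVp hP)
  refine ⟨s, fun R hR => ?_⟩
  by_contra! h
  have hc' : ContinuousOn (fun P : Jet => ((s : ℤ) : ℝ) * P.2.2) V := by fun_prop
  obtain ⟨Q, hQ, h0⟩ := hVc.isPreconnected.intermediate_value hR hP hc' ⟨h, hs.le⟩
  exact mul_ne_zero (cast_units_ne_zero s) (hVp hQ) h0

theorem unit_mul_zpow_pos {s ε : ℤˣ} {p : ℝ} (h : 0 < ((s : ℤ) : ℝ) * p) :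
    0 < ((s : ℤ) : ℝ) * p ^ (ε : ℤ) := by
  rcases Int.units_eq_one_or ε with rfl | rfl
  · simpa using h
  · rcases Int.units_eq_one_or s with rfl | rfl <;> simp at h ⊢ <;> exact h

theorem NormalFormOn.contEquiv {m : ℝ} (hm : m ≠ 0) {V : Set Jet} (hVc : IsConnected V)
    (hVp : V ⊆ phase) {Γ : Jet → Jet} {k l : ℝ} {ε : ℤˣ} {H H₁ : ℝ → ℝ}
    (hΓ : NormalFormOn (-1 / m) V Γ k l ε H H₁) {s t : ℤˣ} (hs : 0 < (s : ℤ) * k)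
    (ht : 0 < (t : ℤ) * l) :
    (familyODE m).ContEquiv V (toMap (discretePerm (s, t, ε))) Γ := by
  obtain ⟨σ, hσ⟩ := exists_sign hVc hVp
  have hss := cast_units_sq s
  have htt := cast_units_sq t
  have hτ : ((σ : ℤ) : ℝ) * ((t : ℤ) : ℝ) ≠ 0 :=
    mul_ne_zero (cast_units_ne_zero σ) (cast_units_ne_zero t)
  have hd : ∀ P ∈ V, toMap (discretePerm (s, t, ε)) P = discreteMap (s, t, ε) P :=
    fun P hP => toMap_discretePerm _ (hVp hP)
  have hN : ∀ P ∈ V, toMap (discretePerm (s, t, ε)) P ∈ halfPhase ((σ : ℤ) * (t : ℤ)) :=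
    fun P hP => by
      rw [hd P hP]
      change 0 < ((σ : ℤ) : ℝ) * (t : ℤ) * ((t : ℤ) * P.2.2 ^ (ε : ℤ))
      have := unit_mul_zpow_pos (ε := ε) (hσ P hP)
      calc (0 : ℝ) < (σ : ℤ) * P.2.2 ^ (ε : ℤ) := this
        _ = _ := by linear_combination (-(((σ : ℤ) : ℝ) * P.2.2 ^ (ε : ℤ))) * htt
  -- The scaling flow multiplies `z` and `w` by `exp c = |k|` and `p` by `exp (c + α) = |l|`. Then
  -- only the shift by `H` remains, and it is a translation flow.
  set c := Real.log ((s : ℤ) * k)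
  set α := Real.log ((t : ℤ) * l) - c with hα
  have hec : Real.exp c = (s : ℤ) * k := Real.exp_log hs
  have heca : Real.exp (c + α) = (t : ℤ) * l := by
    rw [hα, add_sub_cancel, Real.exp_log ht]
  set Γm : Jet → Jet := fun P => (Real.exp (-α) * (toMap (discretePerm (s, t, ε)) P).1,
    Real.exp c * (toMap (discretePerm (s, t, ε)) P).2.1,
    Real.exp (c + α) * (toMap (discretePerm (s, t, ε)) P).2.2) with hΓm
  have hpm : ∀ P ∈ V, (Γm P).2.2 = (Γ P).2.2 := fun P hP => by
    change Real.exp (c + α) * (toMap (discretePerm (s, t, ε)) P).2.2 = _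
    rw [hΓ.p_eq P hP, heca, hd P hP]
    change ((t : ℤ) : ℝ) * l * ((t : ℤ) * P.2.2 ^ (ε : ℤ)) = _
    linear_combination (l * P.2.2 ^ (ε : ℤ)) * htt
  have hexp : Real.exp (-α) * Real.exp (c + α) = Real.exp c := by
    rw [← Real.exp_add]
    congr 1
    ring
  have hzm : ∀ P ∈ V, zCoord (Γm P) = k * zCoord P := fun P hP => by
    have h : zCoord (Γm P) = Real.exp c * zCoord (discreteMap (s, t, ε) P) := by
      rw [← hd P hP, ← hexp]
      simp only [zCoord, hΓm]
      ring
    rw [h, zCoord_discreteMap _ (hVp hP), hec]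
    linear_combination (k * zCoord P) * hss
  have hwm : ∀ P ∈ V, wCoord (Γm P) = k * (ε : ℤ) * wCoord P := fun P hP => by
    have h : wCoord (Γm P) = Real.exp c * wCoord (discreteMap (s, t, ε) P) := by
      have h' := hexp
      rw [← hd P hP]
      simp only [wCoord, hΓm]
      linear_combination (-((toMap (discretePerm (s, t, ε)) P).1
        * (toMap (discretePerm (s, t, ε)) P).2.2)) * h'
    rw [h, wCoord_discreteMap _ (hVp hP), hec]
    linear_combination (k * (ε : ℤ) * wCoord P) * hss
  have hNm : ∀ P ∈ V, Γm P ∈ halfPhase ((σ : ℤ) * (t : ℤ)) := fun P hP => by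
    have h : 0 < ((σ : ℤ) : ℝ) * (t : ℤ) * (toMap (discretePerm (s, t, ε)) P).2.2 := hN P hP
    change 0 < ((σ : ℤ) : ℝ) * (t : ℤ) *
      (Real.exp (c + α) * (toMap (discretePerm (s, t, ε)) P).2.2)
    rw [mul_left_comm]
    exact mul_pos (Real.exp_pos _) h
  refine Relation.EqvGen.trans _ Γm _
    (Relation.EqvGen.rel _ _ (flowStep_scaling hm c α hτ hN fun P _ => rfl))
    (Relation.EqvGen.rel _ _ (flowStep_translation hm hΓ.euler hτ hNm fun P hP => ?_))
  have hp : (Γm P).2.2 ≠ 0 := halfPhase_subset_phase _ (hNm P hP)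
  refine jet_ext_coord hp (hpm P hP).symm ?_ ?_
  · rw [hΓ.z_eq P hP, ← hzm P hP, ← hpm P hP]
    simp only [zCoord]
    field_simp
  · rw [hΓ.w_eq P hP, ← hwm P hP, ← hpm P hP]
    simp only [wCoord]
    field_simp
    ring

/-! ### Invariants of the equivalence -/

theorem eq_exp_mul_of_hasDerivAt {u : ℝ → ℝ} {a : ℝ}
    (hu : ∀ t ∈ Set.Icc (0 : ℝ) 1, HasDerivAt u (a * u t) t) :
    ∀ t ∈ Set.Icc (0 : ℝ) 1, u t = Real.exp (a * t) * u 0 := by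
  have hd : ∀ t ∈ Set.Icc (0 : ℝ) 1, HasDerivAt (fun t => Real.exp (-a * t) * u t) 0 t := by
    intro t ht
    refine ((((hasDerivAt_id t).const_mul (-a)).exp).mul (hu t ht)).congr_deriv ?_
    simp
    ring
  intro t ht
  have h := constant_of_has_deriv_right_zero
    (fun t ht => (hd t ht).continuousAt.continuousWithinAt)
    (fun t ht => (hd t (Set.Ico_subset_Icc_self ht)).hasDerivWithinAt) t ht
  simp only [mul_zero, Real.exp_zero, one_mul] at h
  rw [← h, ← mul_assoc, ← Real.exp_add]
  simp

/-- `Γ'` arises from `Γ` by a positive scaling of `p` and, where `p` agrees, a positive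
scaling of differences of `y - x p`. -/
def Comparable (V : Set Jet) (Γ Γ' : Jet → Jet) : Prop :=
  ∃ l K : ℝ, 0 < l ∧ 0 < K ∧ (∀ P ∈ V, (Γ' P).2.2 = l * (Γ P).2.2) ∧
    ∀ P ∈ V, ∀ R ∈ V, (Γ P).2.2 = (Γ R).2.2 →
      wCoord (Γ' P) - wCoord (Γ' R) = K * (wCoord (Γ P) - wCoord (Γ R))

/-- Along a generator `p' = (c + α) p` and `w' = c w + g(p)` in the flow time. Two orbits starting
with equal `p` keep equal `p`, so the term `g(p)` cancels in their difference of `w`. -/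
theorem comparable_of_flowStep {m : ℝ} (hm : m ≠ 0) {V : Set Jet} {Γ Γ' : Jet → Jet}
    (h : (familyODE m).FlowStep V Γ Γ') : Comparable V Γ Γ' := by
  obtain ⟨N, X, γ, hN, hNc, hNp, hX, hγ⟩ := h
  obtain ⟨C, S, hCS⟩ := exists_isEulerSystem (κ := -1 / m) (div_ne_zero (by norm_num) hm)
  obtain ⟨c, α, a, b, hX'⟩ := exists_eq_generatorField hm hCS hN hNc.isPreconnected hNp hX
  set g : ℝ → ℝ := fun p => a * C p + b * S p
  set g₁ : ℝ → ℝ := fun p => a * (-1 / m * S p) + b * C p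
  have hder : ∀ P ∈ V, ∀ t ∈ Set.Icc (0 : ℝ) 1,
      HasDerivAt (fun s => γ s P) (generatorField c α g g₁ (γ t P)) t := fun P hP t ht => by
    obtain ⟨h1, h2⟩ := (hγ P hP).2.2 t ht
    rwa [hX' _ h1] at h2
  have hp : ∀ P ∈ V, ∀ t ∈ Set.Icc (0 : ℝ) 1,
      (γ t P).2.2 = Real.exp ((c + α) * t) * (γ 0 P).2.2 := fun P hP =>
    eq_exp_mul_of_hasDerivAt (u := fun t => (γ t P).2.2) fun t ht => (hder P hP t ht).snd.snd
  have hw : ∀ P ∈ V, ∀ t ∈ Set.Icc (0 : ℝ) 1, HasDerivAt (fun s => wCoord (γ s P))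
      (c * wCoord (γ t P) + g (γ t P).2.2) t := fun P hP t ht => by
    have h := hder P hP t ht
    have h0 : (γ t P).2.2 ≠ 0 := hNp ((hγ P hP).2.2 t ht).1
    have hx : HasDerivAt (fun s => (γ s P).1) (generatorField c α g g₁ (γ t P)).1 t := h.fst
    have hy : HasDerivAt (fun s => (γ s P).2.1) (generatorField c α g g₁ (γ t P)).2.1 t := h.snd.fst
    have hp : HasDerivAt (fun s => (γ s P).2.2) (generatorField c α g g₁ (γ t P)).2.2 t := h.snd.snd
    refine (hy.sub (hx.mul hp)).congr_deriv ?_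
    simp only [generatorField, wCoord]
    field_simp
    ring
  have e0 : (0 : ℝ) ∈ Set.Icc (0 : ℝ) 1 := by simp
  have e1 : (1 : ℝ) ∈ Set.Icc (0 : ℝ) 1 := by simp
  refine ⟨Real.exp (c + α), Real.exp c, Real.exp_pos _, Real.exp_pos _, fun P hP => ?_,
    fun P hP R hR hPR => ?_⟩
  · rw [← (hγ P hP).1, ← (hγ P hP).2.1, hp P hP 1 e1, mul_one]
  · rw [← (hγ P hP).1, ← (hγ R hR).1] at hPR
    have h := eq_exp_mul_of_hasDerivAt (a := c) (u := fun t => wCoord (γ t P) - wCoord (γ t R))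
      (fun t ht => ((hw P hP t ht).sub (hw R hR t ht)).congr_deriv (by
        rw [hp P hP t ht, hp R hR t ht, hPR]
        ring)) 1 e1
    rw [← (hγ P hP).1, ← (hγ R hR).1, ← (hγ P hP).2.1, ← (hγ R hR).2.1]
    simpa using h

theorem comparable_of_contEquiv {m : ℝ} (hm : m ≠ 0) {V : Set Jet} {Γ Γ' : Jet → Jet}
    (h : (familyODE m).ContEquiv V Γ Γ') : Comparable V Γ Γ' := by
  induction h with
  | rel _ _ h => exact comparable_of_flowStep hm h
  | refl _ => exact ⟨1, 1, one_pos, one_pos, by simp, by simp⟩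
  | symm Γ Γ' _ ih =>
    obtain ⟨l, K, hl, hK, h1, h2⟩ := ih
    refine ⟨l⁻¹, K⁻¹, inv_pos.2 hl, inv_pos.2 hK, fun P hP => ?_, fun P hP R hR h => ?_⟩
    · rw [h1 P hP]; field_simp
    · rw [h1 P hP, h1 R hR] at h
      rw [h2 P hP R hR (mul_left_cancel₀ hl.ne' h)]
      field_simp
  | trans Γ Γ' Γ'' _ _ ih ih' =>
    obtain ⟨l, K, hl, hK, h1, h2⟩ := ih
    obtain ⟨l', K', hl', hK', h1', h2'⟩ := ih'
    refine ⟨l' * l, K' * K, mul_pos hl' hl, mul_pos hK' hK, fun P hP => ?_, fun P hP R hR h => ?_⟩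
    · rw [h1' P hP, h1 P hP, mul_assoc]
    · rw [h2' P hP R hR (by rw [h1 P hP, h1 R hR, h]), h2 P hP R hR h, mul_assoc]

theorem unit_eq_of_pos_mul {s t : ℤˣ} {a : ℝ} (ha : 0 < a)
    (h : ((s : ℤ) : ℝ) = a * ((t : ℤ) : ℝ)) : s = t := by
  rcases Int.units_eq_one_or s with rfl | rfl <;> rcases Int.units_eq_one_or t with rfl | rfl
  · rfl
  · simp at h; linarith
  · simp at h; linarith
  · rfl

theorem eq_of_comparable {V : Set Jet} (hV : IsOpen V) (hVne : V.Nonempty) (hVp : V ⊆ phase)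
    {d e : ℤˣ × ℤˣ × ℤˣ}
    (h : Comparable V (toMap (discretePerm d)) (toMap (discretePerm e))) : d = e := by
  obtain ⟨l, K, hl, hK, h1, h2⟩ := h
  obtain ⟨P, hP⟩ := hVne
  have hp : P.2.2 ≠ 0 := hVp hP
  have hd : ∀ (f : ℤˣ × ℤˣ × ℤˣ), ∀ R ∈ V, toMap (discretePerm f) R = discreteMap f R :=
    fun f R hR => toMap_discretePerm f (hVp hR)
  have h1' : ∀ R ∈ V, ((e.2.1 : ℤ) : ℝ) * R.2.2 ^ (e.2.2 : ℤ)
      = l * ((d.2.1 : ℤ) * R.2.2 ^ (d.2.2 : ℤ)) := fun R hR => by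
    have := h1 R hR
    rwa [hd _ R hR, hd _ R hR] at this
  have hu : d.2.2 = e.2.2 := by
    by_contra hne
    -- If the exponents differed, `p ^ ε` and `p ^ (-ε)` would be proportional on `V`, so `p²` would
    -- be constant there; scaling `p` by `1 + t` with small `t > 0` refutes this.
    have hsq : ∀ R ∈ V, ((d.2.1 : ℤ) : ℝ) * (e.2.1 : ℤ) * (P.2.2 ^ 2 - R.2.2 ^ 2) = 0 := by
      intro R hR
      have hr : R.2.2 ≠ 0 := hVp hR
      have a1 := h1' P hP
      have a2 := h1' R hR
      have b1 := cast_units_sq d.2.1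
      have b2 := cast_units_sq e.2.1
      rcases Int.units_eq_one_or d.2.2 with h | h <;>
        rcases Int.units_eq_one_or e.2.2 with h' | h' <;> rw [h, h'] at a1 a2
      · exact absurd (h.trans h'.symm) hne
      · simp at a1 a2
        field_simp at a1 a2
        have : l * (P.2.2 ^ 2 - R.2.2 ^ 2) = 0 := by
          linear_combination (-((d.2.1 : ℤ) : ℝ)) * a1 + ((d.2.1 : ℤ) : ℝ) * a2
            - l * (P.2.2 ^ 2 - R.2.2 ^ 2) * b1
        rw [(mul_eq_zero.1 this).resolve_left hl.ne', mul_zero]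
      · simp at a1 a2
        field_simp at a1 a2
        linear_combination ((d.2.1 : ℤ) : ℝ) * a1 - ((d.2.1 : ℤ) : ℝ) * a2
      · exact absurd (h.trans h'.symm) hne
    have hc : Continuous fun t : ℝ => ((P.1, P.2.1, P.2.2 * (1 + t)) : Jet) := by fun_prop
    have hev : ∀ᶠ t : ℝ in nhds 0, ((P.1, P.2.1, P.2.2 * (1 + t)) : Jet) ∈ V :=
      hc.continuousAt.eventually_mem (hV.mem_nhds (by simpa using hP))
    obtain ⟨t, ht, ht0⟩ :=
      ((hev.filter_mono (nhdsWithin_le_nhds (s := Set.Ioi 0))).and self_mem_nhdsWithin).exists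
    have ht0' : 0 < t := ht0
    have := hsq _ ht
    have h0 : ((d.2.1 : ℤ) : ℝ) * (e.2.1 : ℤ) * P.2.2 ^ 2 * (t * (2 + t)) ≠ 0 :=
      mul_ne_zero (mul_ne_zero (mul_ne_zero (cast_units_ne_zero _) (cast_units_ne_zero _))
        (by positivity)) (by positivity)
    apply h0
    simp only at this
    linear_combination -this
  have ht : e.2.1 = d.2.1 := by
    refine unit_eq_of_pos_mul hl (mul_right_cancel₀ (zpow_ne_zero (d.2.2 : ℤ) hp) ?_)
    have := h1' P hP
    rw [← hu] at this
    rw [this]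
    ring
  have hs : e.1 = d.1 := by
    -- Two points on a vertical line have equal `p̂`, so the scaling of `w`-differences applies and
    -- compares the signs `s`.
    obtain ⟨t, ht, ht0⟩ : ∃ t : ℝ, P + (0, t, 0) ∈ V ∧ t ≠ 0 := by
      have h := (eventually_vertical_mem hV hP).filter_mono (nhdsWithin_le_nhds (s := {0}ᶜ))
      exact (h.and self_mem_nhdsWithin).exists
    have h := h2 _ ht P hP (by
      rw [hd _ _ ht, hd _ _ hP]
      simp [discreteMap])
    rw [hd _ _ ht, hd _ _ hP, hd _ _ ht, hd _ _ hP, wCoord_discreteMap _ (hVp ht),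
      wCoord_discreteMap _ (hVp hP), wCoord_discreteMap _ (hVp ht),
      wCoord_discreteMap _ (hVp hP), ← hu] at h
    have hw : wCoord (P + (0, t, 0)) = wCoord P + t := by
      simp [wCoord]
      ring
    rw [hw] at h
    refine unit_eq_of_pos_mul hK (mul_right_cancel₀
      (mul_ne_zero (cast_units_ne_zero d.2.2) ht0) ?_)
    linear_combination h
  exact Prod.ext hs.symm (Prod.ext ht.symm hu)

theorem eq_of_contEquiv {m : ℝ} (hm : m ≠ 0) {V : Set Jet} (hV : IsOpen V) (hVne : V.Nonempty)
    (hVp : V ⊆ phase) {d e : ℤˣ × ℤˣ × ℤˣ} {Γ : Jet → Jet}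
    (hd : (familyODE m).ContEquiv V (toMap (discretePerm d)) Γ)
    (he : (familyODE m).ContEquiv V (toMap (discretePerm e)) Γ) : d = e :=
  eq_of_comparable hV hVne hVp
    (comparable_of_contEquiv hm (Relation.EqvGen.trans _ _ _ hd (Relation.EqvGen.symm _ _ he)))

/-- `p ↦ (p / l) ^ ε` inverts `p ↦ l p ^ ε`. It expresses the shift of the inner map as a function
of the outer `p̂` in `NormalFormOn.comp`. -/
theorem IsEuler.comp_zpow {κ : ℝ} {h h₁ : ℝ → ℝ} (H : IsEuler κ h h₁) {l : ℝ} (hl : l ≠ 0)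
    (ε : ℤˣ) : IsEuler κ (fun p => ((ε : ℤ) : ℝ) * h ((p / l) ^ (ε : ℤ)))
      (fun p => h₁ ((p / l) ^ (ε : ℤ))) := by
  rcases Int.units_eq_one_or ε with rfl | rfl
  · simpa using H.comp_div hl
  · simpa using H.comp_inv.comp_div hl

theorem NormalFormOn.comp {κ : ℝ} {V V' : Set Jet} {Γ Γ' : Jet → Jet}
    {k l k' l' : ℝ} {ε ε' : ℤˣ} {H H₁ H' H₁' : ℝ → ℝ}
    (hΓ' : NormalFormOn κ V' Γ' k' l' ε' H' H₁') (hΓ : NormalFormOn κ V Γ k l ε H H₁)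
    (hm : Set.MapsTo Γ V V') :
    ∃ G G₁, NormalFormOn κ V (Γ' ∘ Γ) (k' * k) (l' * l ^ (ε' : ℤ)) (ε' * ε) G G₁ := by
  have hinv : ∀ P ∈ V, ((Γ' (Γ P)).2.2 / l') ^ (ε' : ℤ) = (Γ P).2.2 := fun P hP => by
    rw [hΓ'.p_eq _ (hm hP), mul_div_cancel_left₀ _ hΓ'.l_ne_zero, ← zpow_mul]
    have : (ε' : ℤ) * (ε' : ℤ) = 1 := by
      rcases Int.units_eq_one_or ε' with rfl | rfl <;> rfl
    rw [this, zpow_one]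
  refine ⟨_, _, mul_ne_zero hΓ'.k_ne_zero hΓ.k_ne_zero,
    mul_ne_zero hΓ'.l_ne_zero (zpow_ne_zero _ hΓ.l_ne_zero),
    (hΓ.euler.comp_zpow hΓ'.l_ne_zero ε').linearCombination hΓ'.euler k' 1, fun P hP => ?_,
    fun P hP => ?_, fun P hP => ?_⟩
  · rw [Function.comp_apply, hΓ'.p_eq _ (hm hP), hΓ.p_eq P hP, mul_zpow, ← zpow_mul,
      Units.val_mul, mul_comm (ε : ℤ), mul_assoc]
  · rw [Function.comp_apply, hΓ'.z_eq _ (hm hP), hΓ.z_eq P hP, hinv P hP]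
    ring
  · rw [Function.comp_apply, hΓ'.w_eq _ (hm hP), hΓ.w_eq P hP, hinv P hP]
    push_cast
    ring

theorem familyODE_discreteSymmetriesGenerated {m : ℝ} (hm : m ≠ 0) :
    (familyODE m).DiscreteSymmetriesGenerated where
  iso := nonempty_discreteGroup_mulEquiv
  isSymmetry _ hd := isUniformContactSymmetryOn_toMap m hd
  classification V hV hVc hVp Γ hΓ := by
    obtain ⟨k, l, ε, H, H₁, h⟩ := exists_normalFormOn hm hV hVc hVp hΓ
    obtain ⟨s, hs⟩ := exists_unit_pos h.k_ne_zero
    obtain ⟨t, ht⟩ := exists_unit_pos h.l_ne_zero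
    have hc := h.contEquiv hm hVc hVp hs ht
    refine ⟨_, ⟨by rw [discreteGroup_eq_range]; exact ⟨_, rfl⟩, hc⟩, ?_⟩
    rintro d ⟨hd, hd'⟩
    rw [discreteGroup_eq_range] at hd
    obtain ⟨d, rfl⟩ := hd
    rw [eq_of_contEquiv hm hV hVc.nonempty hVp hd' hc]
  composition V V' hV hVc hVp hV' hVc' hVp' Γ Γ' hΓ hΓ' hmaps d hd d' hd' he he' := by
    rw [discreteGroup_eq_range] at hd hd'
    obtain ⟨d, rfl⟩ := hd
    obtain ⟨d', rfl⟩ := hd'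
    obtain ⟨k, l, ε, H, H₁, h⟩ := exists_normalFormOn hm hV hVc hVp hΓ
    obtain ⟨k', l', ε', H', H₁', h'⟩ := exists_normalFormOn hm hV' hVc' hVp' hΓ'
    obtain ⟨s, hs⟩ := exists_unit_pos h.k_ne_zero
    obtain ⟨t, ht⟩ := exists_unit_pos h.l_ne_zero
    obtain ⟨s', hs'⟩ := exists_unit_pos h'.k_ne_zero
    obtain ⟨t', ht'⟩ := exists_unit_pos h'.l_ne_zero
    -- Uniqueness identifies the given group element with the sign pattern of the normal form of
    -- `Γ`.
    obtain rfl := eq_of_contEquiv hm hV hVc.nonempty hVp he (h.contEquiv hm hVc hVp hs ht)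
    obtain rfl := eq_of_contEquiv hm hV' hVc'.nonempty hVp' he' (h'.contEquiv hm hVc' hVp' hs' ht')
    obtain ⟨G, G₁, hG⟩ := h'.comp h hmaps
    rw [← map_mul]
    -- The composite has factors `k' k` and `l' l ^ ε'`; as `l ^ ε'` has the sign of `l`, the signs
    -- multiply.
    refine hG.contEquiv hm hVc hVp (s := s' * s) (t := t' * t) ?_ ?_
    · push_cast
      calc (0 : ℝ) < ((s' : ℤ) * k') * ((s : ℤ) * k) := mul_pos hs' hs
        _ = _ := by ring
    · push_cast
      calc (0 : ℝ) < ((t' : ℤ) * l') * ((t : ℤ) * l ^ (ε' : ℤ)) :=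
            mul_pos ht' (unit_mul_zpow_pos ht)
        _ = _ := by ring

end UniformContact

end

theorem mainTheorem5 :
    (∀ V : Set UniformContact.Jet, IsOpen V → IsConnected V → V ⊆ UniformContact.phase →
      ∃ e : (UniformContact.A1 × UniformContact.A1) →ₗ[ℝ]
          (UniformContact.Jet → UniformContact.Jet),
        UniformContact.mainODE.IsGeneratorIso V e ∧
        ∀ P ∈ V,
          e (UniformContact.A1.e₁, 0) P = UniformContact.X₁ P ∧
          e (UniformContact.A1.e₂, 0) P = UniformContact.X₂ P ∧
          e (0, UniformContact.A1.e₁) P = UniformContact.X₃ P ∧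
          e (0, UniformContact.A1.e₂) P = UniformContact.X₄ P) ∧
    UniformContact.mainODE.DiscreteSymmetriesGenerated ∧
    (∀ m : ℝ, m ≠ 0 → (UniformContact.familyODE m).DiscreteSymmetriesGenerated) ∧
    (∀ m : ℝ, m < 0 → ∀ V : Set UniformContact.Jet,
      IsOpen V → IsConnected V → V ⊆ UniformContact.phase →
      ∃ e : (UniformContact.A1 × UniformContact.A1) →ₗ[ℝ]
          (UniformContact.Jet → UniformContact.Jet),
        (UniformContact.familyODE m).IsGeneratorIso V e) := by
  refine ⟨fun V hV hVc hVp => UniformContact.mainODE_generators hV hVc hVp, ?_,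
    fun m hm => UniformContact.familyODE_discreteSymmetriesGenerated hm,
    fun m hm V hV hVc hVp => UniformContact.familyODE_generators hm hV hVc hVp⟩
  rw [UniformContact.mainODE_eq]
  exact UniformContact.familyODE_discreteSymmetriesGenerated (by norm_num)
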